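/- An allowable sequence on $2n$ points is a sequence $\Pi=\{\pi_i\}_{i\in\mathbb Z}$ of permutations of the points such that (a) for some $h\ge 1$, $\pi_{i+h}$ is the reversal of $\pi_i$ for every $i$; (b) $\pi_i$ is obtained from $\pi_{i-1}$ (the $i$-th move) by reversing one or more disjoint substrings of consecutive elements, of at least two elements each (these reversals are called switches); (c) any two points participate together in exactly one switch within a halfperiod $\pi_m,\pi_{m+1},\dots,\pi_{m+h}$. A switch of a centered substring is called a crossing switch. Let $t\ge 2$, let $d=(d_1,\dots,d_t)$ be positive integers, and let $\Pi=\mathrm{DC}^{cs}_{ncgen}(d_1,\dots,d_t)$, that is, the allowable sequence on the $2n$ points $1,\dots,n,\overline n,\dots,\overline 1$ ($n=d_1+\dots+d_t$) with $\pi_0=(1,2,\dots,n,\overline n,\dots,\overline 2,\overline 1)$ which is - even-near-critical: $h=2n$; - centrally symmetric: every point $p$ has a conjugate $\overline p$ such that, in every $\pi_i$, the positions of $p$ and $\overline p$ add up to $2n+1$; - in noncentral general position: every switch that is not a crossing switch reverses exactly two points; - of central signature $d$: there are exactly $t$ crossing switches in the halfperiod $\pi_0,\dots,\pi_{2n}$,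 and for each $k$ the $k$-th of them reverses a set $s_k$ of $2d_k$ points; and whose first move (from $\pi_0$ to $\pi_1$) includes a crossing switch. A geometric realization of $\Pi$ is a set $P$ of $2n$ distinct points of the plane, labelled by the points of $\Pi$, whose circular sequence (the successive orders of the projections of $P$ onto a rotating directed line) is $\Pi$. Suppose that $d_i\ge 2$ for some $i$, let $j\ne i$, and suppose that $\Pi$ is geometrically realizable. Then in any geometric realization of $\Pi$, the set $S$ of the points labelled by $s_i\cup s_j$ satisfies: 1. if $d_j=1$, then $S$ is a centrally symmetric bipencil, that is, a finite centrally symmetric set all but exactly two of whose points lie on a common line; 2. if $d_j\ge 2$, then for some real $\lambda>1$ the set $S$ is affinely equivalent to the exponential cross without its center $$\mathrm{EX}^*_\lambda(d_i-1,d_j-1)=\{(\pm\lambda^{a},0),(0,\pm\lambda^{b}) : 0\le a\le d_i-1,\ 0\le b\le d_j-1\}.$$ -/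

import Mathlib

/-- An allowable sequence on the `N` points `Fin N`. `perm i p` is the position (counted from `0`)
of the point `p` in the `i`-th permutation `π_i`. A switch is recorded as the pair `(a, b)`, `a < b`,
of the first and last position of the substring that it reverses, and `switches i` is the set of
switches of the `i`-th move, which leads from `π_{i-1}` to `π_i`. -/
structure AllowableSequence (N : ℕ) where
  perm : ℤ → Equiv.Perm (Fin N)
  /-- the length `h` of a halfperiod -/
  halfLength : ℕ
  switches : ℤ → Finset (Fin N × Fin N)
  halfLength_pos : 0 < halfLength
  /-- `π_{i+h}` is the reversal of `π_i` -/
  perm_add_halfLength : ∀ (i : ℤ) (p : Fin N), perm (i + halfLength) p = Fin.rev (perm i p)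
  /-- every move has at least one switch -/
  switches_nonempty : ∀ i, (switches i).Nonempty
  /-- a switch involves at least two positions -/
  switch_lt : ∀ i, ∀ s ∈ switches i, s.1 < s.2
  /-- the switches of one move act on disjoint substrings -/
  switches_disjoint : ∀ i, ∀ s ∈ switches i, ∀ s' ∈ switches i, s ≠ s' →
    Disjoint (Finset.Icc s.1 s.2) (Finset.Icc s'.1 s'.2)
  /-- a switch `(a, b)` reverses the substring in the positions `a, …, b` -/
  perm_of_mem : ∀ i, ∀ s ∈ switches i, ∀ p, perm (i - 1) p ∈ Finset.Icc s.1 s.2 →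
    (perm i p : ℕ) + (perm (i - 1) p : ℕ) = (s.1 : ℕ) + (s.2 : ℕ)
  /-- the points outside all switches of a move stay where they are -/
  perm_of_notMem : ∀ i p, (∀ s ∈ switches i, perm (i - 1) p ∉ Finset.Icc s.1 s.2) →
    perm i p = perm (i - 1) p
  /-- any pair of points participates in a switch exactly once within a halfperiod
  `π_m, π_{m+1}, …, π_{m+h}` -/
  switch_once : ∀ (m : ℤ) (p q : Fin N), p ≠ q →
    ∃! i : ℤ, (m < i ∧ i ≤ m + halfLength) ∧ ∃ s ∈ switches i,
      perm (i - 1) p ∈ Finset.Icc s.1 s.2 ∧ perm (i - 1) q ∈ Finset.Icc s.1 s.2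

namespace AllowableSequence

variable {N : ℕ}

/-- A substring of positions `a, …, b` is centered if its first and last position are symmetric.
A switch that reverses a centered substring is a crossing switch. -/
def IsCentered (s : Fin N × Fin N) : Prop := s.2 = Fin.rev s.1

/-- Every point `p` has a conjugate point `q` that is in the position symmetric to that of `p`
in all the permutations of the sequence. -/
def IsCentrallySymmetric (A : AllowableSequence N) : Prop :=
  ∀ p, ∃ q, ∀ i, A.perm i q = Fin.rev (A.perm i p)

/-- All switches, except perhaps the crossing switches, are transpositions. -/
def InNoncentralGeneralPosition (A : AllowableSequence N) : Prop :=
  ∀ i, ∀ s ∈ A.switches i, ¬ IsCentered s → (s.2 : ℕ) = (s.1 : ℕ) + 1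

/-- The number of points is even and equal to the number of directions, that is, to the length
of a halfperiod. -/
def IsEvenNearCritical (A : AllowableSequence N) : Prop :=
  Even N ∧ A.halfLength = N

/-- The `j`-th move belongs to the halfperiod `π_0, …, π_h` and includes a crossing switch. -/
def IsCrossingMove (A : AllowableSequence N) (j : ℕ) : Prop :=
  (1 ≤ j ∧ j ≤ A.halfLength) ∧ ∃ s ∈ A.switches j, IsCentered s

/-- The set of points of the `i`-th crossing substring `s_i`, with `i` counted from `0`: the points
reversed by the `i`-th crossing switch in the halfperiod `π_0, …, π_h`. (For `i` smaller than the
number of crossing moves, `Nat.nth A.IsCrossingMove i` is the `i`-th crossing move in increasing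
order; a move has at most one crossing switch.) -/
def crossingSubstring (A : AllowableSequence N) (i : ℕ) : Set (Fin N) :=
  {p | ∃ s ∈ A.switches (Nat.nth A.IsCrossingMove i), IsCentered s ∧
    A.perm ((Nat.nth A.IsCrossingMove i : ℤ) - 1) p ∈ Finset.Icc s.1 s.2}

/-- The central signature of `A` is `(d_0, …, d_{t-1})`: there are exactly `t` crossing switches in
the halfperiod `π_0, …, π_h`, and the `i`-th of them reverses `2 d_i` points. -/
def HasCentralSignature (A : AllowableSequence N) {t : ℕ} (d : Fin t → ℕ) : Prop :=
  {j | A.IsCrossingMove j}.ncard = t ∧ ∀ i : Fin t, (A.crossingSubstring i).ncard = 2 * d i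

/-- `A` is the even-near-critical centrally symmetric allowable sequence in noncentral general
position with central signature `d`, normalized so that its first move includes a crossing switch
and `π_0 = (1, 2, …, n, n̄, …, 2̄, 1̄)`. The `2n` points `1, 2, …, n, n̄, …, 2̄, 1̄` are here the
elements of `Fin (2 * n)` in their order; the conjugate of `p` is then `Fin.rev p`. -/
structure IsDCcsncgen {n t : ℕ} (A : AllowableSequence (2 * n)) (d : Fin t → ℕ) : Prop where
  perm_zero : A.perm 0 = 1
  crossing_first : A.IsCrossingMove 1
  centrallySymmetric : A.IsCentrallySymmetric
  evenNearCritical : A.IsEvenNearCritical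
  noncentralGeneralPosition : A.InNoncentralGeneralPosition
  signature : A.HasCentralSignature d

end AllowableSequence

/-- The Euclidean plane. -/
abbrev Plane : Type := EuclideanSpace ℝ (Fin 2)

/-- The unit vector of angle `φ`, directing the line onto which points are projected. -/
noncomputable def unitVec (φ : ℝ) : Plane := !₂[Real.cos φ, Real.sin φ]

/-- The labelled points `P` of the plane are a geometric realization of `A`: they are distinct and
their circular sequence is `A`. A directed line rotates in one of the two senses;
`θ i`, `i ∈ ℤ`, are the successive angles at which two of the points have the same projection, and
while the angle of the line is strictly between `θ i` and `θ (i + 1)`, the projections of the points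
are in the order given by the permutation `π_i`. -/
def IsGeometricRealization {N : ℕ} (A : AllowableSequence N) (P : Fin N → Plane) : Prop :=
  Function.Injective P ∧
  ∃ θ : ℤ → ℝ, (StrictMono θ ∨ StrictAnti θ) ∧
    Set.range θ =
      {φ | ∃ p q, p ≠ q ∧ inner ℝ (P p) (unitVec φ) = inner ℝ (P q) (unitVec φ)} ∧
    ∀ i : ℤ, ∀ φ ∈ Set.uIoo (θ i) (θ (i + 1)), ∀ p q,
      inner ℝ (P p) (unitVec φ) < inner ℝ (P q) (unitVec φ) ↔ A.perm i p < A.perm i q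

/-- A centrally symmetric bipencil: a finite point set, symmetric about some center, all but
exactly two of whose points lie on a common line. -/
def IsCentrallySymmetricBipencil (S : Set Plane) : Prop :=
  S.Finite ∧ (∃ c : Plane, ∀ x ∈ S, AffineEquiv.pointReflection ℝ c x ∈ S) ∧
  ∃ L : AffineSubspace ℝ Plane, Module.finrank ℝ L.direction = 1 ∧ (S \ (L : Set Plane)).ncard = 2

/-- The standard exponential cross `EX*_l(s, t)` without its center: the points
`(± l ^ i, 0)` for `0 ≤ i ≤ s` and `(0, ± l ^ j)` for `0 ≤ j ≤ t`. -/
def expCrossStar (l : ℝ) (s t : ℕ) : Set Plane :=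
  {x | ∃ i ≤ s, x = !₂[l ^ i, 0] ∨ x = !₂[-l ^ i, 0]} ∪
  {x | ∃ j ≤ t, x = !₂[0, l ^ j] ∨ x = !₂[0, -l ^ j]}

/-- Affine equivalence of sets of points of the plane. -/
def AffinelyEquivalent (S T : Set Plane) : Prop :=
  ∃ f : Plane ≃ᵃ[ℝ] Plane, f '' S = T

/-! Take p and q in different crossing substrings. Central symmetry makes pq parallel to p̄q̄ and
pq̄ parallel to p̄q, while pp̄ and qq̄ are not parallel, since these pairs meet in different moves.
So p, p̄ and q, q̄ have a common midpoint o (`add_conj_eq`). The conjugate pairs of one substring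
all meet in one move, so each substring lies on a line through o. This settles d_j = 1.

For d_j ≥ 2 one has to find parallel lines between the two substrings. Let the depth of a point be
its distance from the center of the permutation. Points of a crossing substring cannot meet again
within a halfperiod, so the substring is dismantled from outside at unit speed and, by time
reversal, was built at unit speed. Hence crossings of sizes d and e are at least d + e moves apart.
As the sizes sum to n and h = 2n, the spacing is exact, which fixes parities. The same speed limits
bound each depth from above (`depth_le_formula`). For the n points in one half the bounds are
distinct integers at most n, while the depths are 1, …, n, so every bound is attained
(`depth_eq_formula`).

Consequently points x_r and y_s, at depths r and s of the two substrings and on suitable sides, meet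
in a move depending only on s - r (`switch_of_crossingMove_lt`), so x_r y_s is parallel to x_{r+1}
y_{s+1}. In coordinates a_r, b_s along the two lines this reads a_r b_{s+1} = a_{r+1} b_s: two
geometric progressions with the same ratio (`exists_expPencil`). -/

namespace AllowableSequence

/-! ### Meetings and the order of two points -/

section General

variable {N : ℕ} (A : AllowableSequence N)

/-- The points `p` and `q` participate together in a switch of the `i`-th move. -/
def Switch (i : ℤ) (p q : Fin N) : Prop :=
  ∃ s ∈ A.switches i, A.perm (i - 1) p ∈ Finset.Icc s.1 s.2 ∧ A.perm (i - 1) q ∈ Finset.Icc s.1 s.2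

variable {A} {i j : ℤ} {p q : Fin N}

theorem Switch.symm (h : A.Switch i p q) : A.Switch i q p := by
  obtain ⟨s, hs, h1, h2⟩ := h
  exact ⟨s, hs, h2, h1⟩

theorem Switch.add_halfLength_le (hpq : p ≠ q) (hi : A.Switch i p q) (hj : A.Switch j p q)
    (hij : i < j) : i + A.halfLength ≤ j := by
  by_contra! hlt
  have hu := (A.switch_once (i - 1) p q hpq).unique (y₁ := i) (y₂ := j)
    ⟨⟨by omega, by have := A.halfLength_pos; omega⟩, hi⟩ ⟨⟨by omega, by omega⟩, hj⟩
  omega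

theorem exists_switch (A : AllowableSequence N) (m : ℤ) (hpq : p ≠ q) :
    ∃ i, m < i ∧ i ≤ m + A.halfLength ∧ A.Switch i p q := by
  obtain ⟨i, ⟨⟨h1, h2⟩, h3⟩, -⟩ := A.switch_once m p q hpq
  exact ⟨i, h1, h2, h3⟩

theorem Switch.add_halfLength (hpq : p ≠ q) (hi : A.Switch i p q) :
    A.Switch (i + A.halfLength) p q := by
  obtain ⟨j, h1, h2, hj⟩ := A.exists_switch i hpq
  have := hi.add_halfLength_le hpq hj h1
  rwa [show i + (A.halfLength : ℤ) = j by omega]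

theorem Switch.sub_halfLength (hpq : p ≠ q) (hi : A.Switch i p q) :
    A.Switch (i - A.halfLength) p q := by
  obtain ⟨j, h1, h2, hj⟩ := A.exists_switch (i - A.halfLength - 1) hpq
  have := A.halfLength_pos
  have := hj.add_halfLength_le hpq hi (by omega)
  rwa [show i - (A.halfLength : ℤ) = j by omega]

theorem Switch.lt (hi : A.Switch i p q) (h : A.perm (i - 1) p < A.perm (i - 1) q) :
    A.perm i q < A.perm i p := by
  obtain ⟨s, hs, h1, h2⟩ := hi
  have e1 := A.perm_of_mem i s hs p h1
  have e2 := A.perm_of_mem i s hs q h2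
  rw [Fin.lt_def] at h ⊢
  omega

theorem lt_or_lt_of_disjoint_Icc {a b a' b' : Fin N} (h : a < b) (h' : a' < b')
    (hd : Disjoint (Finset.Icc a b) (Finset.Icc a' b')) : b < a' ∨ b' < a := by
  by_contra! hc
  obtain ⟨h1, h2⟩ := hc
  rw [Finset.disjoint_left] at hd
  rcases le_total a a' with h3 | h3
  · exact hd (a := a') (Finset.mem_Icc.2 ⟨h3, h1⟩) (Finset.mem_Icc.2 ⟨le_rfl, h'.le⟩)
  · exact hd (a := a) (Finset.mem_Icc.2 ⟨le_rfl, h.le⟩) (Finset.mem_Icc.2 ⟨h3, h2⟩)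

theorem perm_lt_of_not_switch (hn : ¬ A.Switch i p q) (h : A.perm (i - 1) p < A.perm (i - 1) q) :
    A.perm i p < A.perm i q := by
  by_cases hp : ∃ s ∈ A.switches i, A.perm (i - 1) p ∈ Finset.Icc s.1 s.2
  · obtain ⟨s, hs, hps⟩ := hp
    have e1 := A.perm_of_mem i s hs p hps
    have l1 := A.switch_lt i s hs
    have hq' : A.perm (i - 1) q ∉ Finset.Icc s.1 s.2 := fun hq => hn ⟨s, hs, hps, hq⟩
    by_cases hq : ∃ s ∈ A.switches i, A.perm (i - 1) q ∈ Finset.Icc s.1 s.2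
    · obtain ⟨s', hs', hqs⟩ := hq
      have e2 := A.perm_of_mem i s' hs' q hqs
      have l2 := A.switch_lt i s' hs'
      have hne : s ≠ s' := by rintro rfl; exact hq' hqs
      have := lt_or_lt_of_disjoint_Icc l1 l2 (A.switches_disjoint i s hs s' hs' hne)
      simp only [Finset.mem_Icc, Fin.lt_def, Fin.le_def] at *
      omega
    · push Not at hq
      have e2 := A.perm_of_notMem i q hq
      rw [e2]
      simp only [Finset.mem_Icc, Fin.lt_def, Fin.le_def] at *
      omega
  · push Not at hp
    have e1 := A.perm_of_notMem i p hp
    rw [e1]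
    by_cases hq : ∃ s ∈ A.switches i, A.perm (i - 1) q ∈ Finset.Icc s.1 s.2
    · obtain ⟨s', hs', hqs⟩ := hq
      have e2 := A.perm_of_mem i s' hs' q hqs
      have := hp s' hs'
      simp only [Finset.mem_Icc, Fin.lt_def, Fin.le_def] at *
      omega
    · push Not at hq
      rwa [A.perm_of_notMem i q hq]

theorem perm_lt_iff_of_not_switch (hn : ¬ A.Switch i p q) :
    A.perm (i - 1) p < A.perm (i - 1) q ↔ A.perm i p < A.perm i q := by
  refine ⟨perm_lt_of_not_switch hn, fun h => ?_⟩
  rcases lt_trichotomy (A.perm (i - 1) p) (A.perm (i - 1) q) with h1 | h1 | h1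
  · exact h1
  · rw [(A.perm (i - 1)).injective h1] at h
    exact absurd h (lt_irrefl _)
  · exact absurd (perm_lt_of_not_switch (fun h => hn h.symm) h1) h.asymm

theorem perm_lt_iff_of_forall_not_switch (hij : i ≤ j)
    (hn : ∀ k, i < k → k ≤ j → ¬ A.Switch k p q) :
    A.perm i p < A.perm i q ↔ A.perm j p < A.perm j q := by
  induction j, hij using Int.leInduction with
  | base => rfl
  | succ j hij ih =>
    rw [ih fun k h1 h2 => hn k h1 (by omega)]
    have := perm_lt_iff_of_not_switch (hn (j + 1) (by omega) le_rfl)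
    rwa [add_sub_cancel_right] at this

/-- The order of two points does not change before they meet again. -/
theorem Switch.perm_lt_iff (hpq : p ≠ q) {k l m : ℤ} (hk : A.Switch k p q) (h1 : k ≤ l)
    (h2 : l < k + A.halfLength) (h3 : k ≤ m) (h4 : m < k + A.halfLength) :
    A.perm l p < A.perm l q ↔ A.perm m p < A.perm m q := by
  have key : ∀ l, k ≤ l → l < k + A.halfLength →
      (A.perm k p < A.perm k q ↔ A.perm l p < A.perm l q) := fun l h1 h2 =>
    perm_lt_iff_of_forall_not_switch h1 fun j hj hj' hs => by
      have := hk.add_halfLength_le hpq hs hj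
      omega
  rw [← key l h1 h2, ← key m h3 h4]

/-- A quantity that moves by unit steps, exchanging values, where two points starting below `d` never
exchange their values. -/
theorem unit_step_bound {X : Type*} (F : ℕ → X → ℤ) (d : ℤ) (h : ℕ)
    (step : ∀ u, u + 1 < h → ∀ p, F (u + 1) p = F u p ∨ ∃ q, F (u + 1) p = F u q ∧
      (F u q = F u p + 1 ∨ F u q + 1 = F u p) ∧ ¬ (F 0 p ≤ d ∧ F 0 q ≤ d)) (u : ℕ) (hu : u < h)
    (p : X) : (F u p ≤ d - u → F 0 p = F u p) ∧ (F 0 p ≤ d - u → F u p = F 0 p) ∧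
      (F 0 p ≤ d → F u p ≤ max (F 0 p) (u - d + 2 * F 0 p)) := by
  -- The core of values at most d - u is still intact after u steps: an exchange reaching the next
  -- core would involve two points that both started at most d.
  have key : ∀ u, u < h → ∀ p,
      (F u p ≤ d - u → F 0 p = F u p) ∧ (F 0 p ≤ d - u → F u p = F 0 p) := by
    intro u
    induction u with
    | zero => simp
    | succ u ih =>
      intro hu p
      have ihu := ih (by omega)
      push_cast
      rcases step u hu p with h1 | ⟨q, h1, h2, h3⟩
      · have := ihu p
        omega
      · have hp := ihu p
        have hq := ihu q
        omega
  -- A point starting at r rests for d - r steps, then gains at most 1 per step: r + (u - (d - r)) =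
  -- u - d + 2r.
  refine ⟨(key u hu p).1, (key u hu p).2, ?_⟩
  induction u with
  | zero => intro _; simp
  | succ u ih =>
    intro hp
    have h0 := (key (u + 1) hu p).2
    have := ih (by omega) hp
    push_cast at *
    rcases step u hu p with h1 | ⟨q, h1, h2, -⟩ <;> omega

end General

/-- The properties of `DC^cs_ncgen(d)` that do not involve the signature. -/
structure IsSymmetricNearCritical {n : ℕ} (A : AllowableSequence (2 * n)) : Prop where
  perm_rev : ∀ i p, A.perm i p.rev = (A.perm i p).rev
  halfLength_eq : A.halfLength = 2 * n
  generalPosition : A.InNoncentralGeneralPosition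

theorem IsDCcsncgen.isSymmetricNearCritical {n t : ℕ} {A : AllowableSequence (2 * n)}
    {d : Fin t → ℕ} (hA : A.IsDCcsncgen d) : A.IsSymmetricNearCritical where
  perm_rev i p := by
    obtain ⟨q, hq⟩ := hA.centrallySymmetric p
    have h0 := hq 0
    rw [hA.perm_zero] at h0
    simp only [Equiv.Perm.coe_one, id_eq] at h0
    rw [← h0, hq]
  halfLength_eq := hA.evenNearCritical.2
  generalPosition := hA.noncentralGeneralPosition

/-! ### Depth and crossing moves -/

section Symmetric

variable {n : ℕ} (A : AllowableSequence (2 * n))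

/-- The distance of the point `p` from the center of the `i`-th permutation, between `1` and `n`. -/
def depth (i : ℤ) (p : Fin (2 * n)) : ℤ :=
  max (n - (A.perm i p : ℕ)) ((A.perm i p : ℕ) + 1 - n)

/-- The `i`-th move includes a crossing switch, which reverses `2 * d` points. -/
def Crosses (i : ℤ) (d : ℕ) : Prop :=
  1 ≤ d ∧ ∃ s ∈ A.switches i, (s.1 : ℕ) + d = n ∧ (s.2 : ℕ) + 1 = n + d

variable {A} {i j : ℤ} {p q : Fin (2 * n)} {d e : ℕ}

theorem rev_ne (p : Fin (2 * n)) : p ≠ p.rev := by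
  intro h
  have := congrArg Fin.val h
  rw [Fin.val_rev] at this
  omega

theorem one_le_depth : 1 ≤ A.depth i p := by
  unfold depth; omega

theorem depth_le : A.depth i p ≤ n := by
  unfold depth; omega

theorem depth_sub_halfLength : A.depth (i - A.halfLength) p = A.depth i p := by
  have := A.perm_add_halfLength (i - A.halfLength) p
  rw [sub_add_cancel] at this
  unfold depth
  rw [this, Fin.val_rev]
  omega

theorem depth_add_halfLength : A.depth (i + A.halfLength) p = A.depth i p := by
  rw [← depth_sub_halfLength, add_sub_cancel_right]

theorem exists_crosses_of_isCentered {s : Fin (2 * n) × Fin (2 * n)} (hs : s ∈ A.switches i)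
    (hc : IsCentered s) : ∃ d, A.Crosses i d ∧ (s.1 : ℕ) + d = n ∧ (s.2 : ℕ) + 1 = n + d := by
  have h1 := A.switch_lt i s hs
  have h2 := congrArg Fin.val (show s.2 = s.1.rev from hc)
  rw [Fin.val_rev] at h2
  rw [Fin.lt_def] at h1
  exact ⟨n - s.1, ⟨by omega, s, hs, by omega, by omega⟩, by omega, by omega⟩

theorem Crosses.exists_isCentered (h : A.Crosses i d) :
    ∃ s ∈ A.switches i, IsCentered s ∧ (s.1 : ℕ) + d = n ∧ (s.2 : ℕ) + 1 = n + d := by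
  obtain ⟨hd, s, hs, h1, h2⟩ := h
  refine ⟨s, hs, ?_, h1, h2⟩
  rw [IsCentered, Fin.ext_iff, Fin.val_rev]
  omega

theorem mem_Icc_iff_depth_le {s : Fin (2 * n) × Fin (2 * n)} (h1 : (s.1 : ℕ) + d = n)
    (h2 : (s.2 : ℕ) + 1 = n + d) :
    A.perm i p ∈ Finset.Icc s.1 s.2 ↔ A.depth i p ≤ d := by
  simp only [Finset.mem_Icc, Fin.le_def, depth]
  omega

theorem Crosses.switch (h : A.Crosses i d) (hp : A.depth (i - 1) p ≤ d)
    (hq : A.depth (i - 1) q ≤ d) : A.Switch i p q := by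
  obtain ⟨hd, s, hs, h1, h2⟩ := h
  exact ⟨s, hs, (mem_Icc_iff_depth_le h1 h2).2 hp, (mem_Icc_iff_depth_le h1 h2).2 hq⟩

theorem Crosses.unique (h : A.Crosses i d) (h' : A.Crosses i e) :
    d = e := by
  obtain ⟨hd, s, hs, h1, h2⟩ := h
  obtain ⟨he, s', hs', h1', h2'⟩ := h'
  by_cases hss : s = s'
  · subst hss; omega
  · have := lt_or_lt_of_disjoint_Icc (A.switch_lt i s hs) (A.switch_lt i s' hs')
      (A.switches_disjoint i s hs s' hs' hss)
    simp only [Fin.lt_def] at this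
    omega

theorem exists_depth_eq (A : AllowableSequence (2 * n)) (i : ℤ) {m : ℤ}
    (h1 : 1 ≤ m) (h2 : m ≤ n) : ∃ p, A.depth i p = m ∧ n ≤ (A.perm i p : ℕ) := by
  refine ⟨(A.perm i).symm ⟨n - 1 + m.toNat, by omega⟩, ?_, ?_⟩
  · rw [depth, Equiv.apply_symm_apply]
    simp only
    omega
  · rw [Equiv.apply_symm_apply]
    simp only
    omega

theorem eq_of_depth_eq (hp : n ≤ (A.perm i p : ℕ))
    (hq : n ≤ (A.perm i q : ℕ)) (h : A.depth i p = A.depth i q) : p = q := by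
  apply (A.perm i).injective
  rw [Fin.ext_iff]
  unfold depth at h
  omega

namespace IsSymmetricNearCritical

variable (hA : A.IsSymmetricNearCritical)
include hA

theorem depth_rev : A.depth i p.rev = A.depth i p := by
  unfold depth
  rw [hA.perm_rev, Fin.val_rev]
  omega

theorem switch_rev (hpq : p ≠ q) (h : A.Switch i p q) : A.Switch i p.rev q.rev := by
  wlog hlt : A.perm (i - 1) p < A.perm (i - 1) q generalizing p q
  · refine (this hpq.symm h.symm (lt_of_le_of_ne (not_lt.1 hlt) fun he => ?_)).symm
    exact hpq.symm ((A.perm (i - 1)).injective he)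
  by_contra hn
  have h1 := h.lt hlt
  have h2 := perm_lt_iff_of_not_switch fun h => hn h.symm
  rw [hA.perm_rev, hA.perm_rev, hA.perm_rev, hA.perm_rev, Fin.rev_lt_rev, Fin.rev_lt_rev] at h2
  exact h1.asymm (h2.1 hlt)

/-- The positions of p and its conjugate add up to 2n - 1 both before and after the switch, which
forces the reversed substring to be centered. -/
theorem exists_crosses_of_switch_rev (h : A.Switch i p p.rev) :
    ∃ d, A.Crosses i d ∧ A.depth (i - 1) p ≤ d := by
  obtain ⟨s, hs, h1, h2⟩ := h
  have e1 := A.perm_of_mem i s hs p h1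
  have e2 := A.perm_of_mem i s hs p.rev h2
  rw [hA.perm_rev, hA.perm_rev, Fin.val_rev, Fin.val_rev] at e2
  have hc : IsCentered s := by
    rw [IsCentered, Fin.ext_iff, Fin.val_rev]
    omega
  obtain ⟨d, hd, h3, h4⟩ := exists_crosses_of_isCentered hs hc
  exact ⟨d, hd, (mem_Icc_iff_depth_le h3 h4).1 h1⟩

theorem switch_rev_iff (h : A.Crosses i d) : A.Switch i p p.rev ↔ A.depth (i - 1) p ≤ d := by
  refine ⟨fun hs => ?_, fun hp => h.switch hp (by rwa [hA.depth_rev])⟩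
  obtain ⟨e, he, hp⟩ := hA.exists_crosses_of_switch_rev hs
  rwa [h.unique he]

/-- The size of a crossing is the greatest depth of a point meeting its conjugate; both depths and
meetings repeat after a halfperiod. -/
theorem crosses_add (h : A.Crosses i d) : A.Crosses (i + (2 * n : ℕ)) d := by
  have hh := hA.halfLength_eq
  rw [← hh]
  have hd1 : 1 ≤ d := h.1
  have hdn : d ≤ n := by
    obtain ⟨-, s, -, h1, -⟩ := h
    omega
  have key : ∀ p, A.depth (i + A.halfLength - 1) p = A.depth (i - 1) p := fun p => by
    rw [← depth_add_halfLength (i := i - 1)]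
    congr 1
    ring
  obtain ⟨p, hp, -⟩ := A.exists_depth_eq (i - 1) (m := d) (by omega) (by omega)
  obtain ⟨e, he, hpe⟩ := hA.exists_crosses_of_switch_rev
    (((hA.switch_rev_iff h).2 hp.le).add_halfLength (rev_ne p))
  have hen : e ≤ n := by
    obtain ⟨-, s, -, h1, -⟩ := he
    omega
  rw [key, hp] at hpe
  obtain ⟨q, hq, -⟩ := A.exists_depth_eq (i - 1) (m := e) (by omega) (by omega)
  have h2 := ((hA.switch_rev_iff he (p := q)).2 (by rw [key, hq])).sub_halfLength (rev_ne q)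
  rw [add_sub_cancel_right] at h2
  have h3 := (hA.switch_rev_iff h).1 h2
  rwa [show d = e by omega]

/-- In one move a point keeps its depth, or it exchanges its depth with a neighbor. -/
theorem depth_step (i : ℤ) (p : Fin (2 * n)) : A.depth i p = A.depth (i - 1) p ∨
    ∃ q, p ≠ q ∧ A.Switch i p q ∧ A.depth i p = A.depth (i - 1) q ∧
      A.depth i q = A.depth (i - 1) p ∧
      (A.depth i p = A.depth i q + 1 ∨ A.depth i p + 1 = A.depth i q) ∧
      ∀ d, A.Crosses i d → d < A.depth (i - 1) p ∧ d < A.depth (i - 1) q := by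
  by_cases hp : ∃ s ∈ A.switches i, A.perm (i - 1) p ∈ Finset.Icc s.1 s.2
  · obtain ⟨s, hs, hps⟩ := hp
    have e1 := A.perm_of_mem i s hs p hps
    have l1 := A.switch_lt i s hs
    -- A centered switch mirrors positions and preserves depth. Any other switch transposes two
    -- neighbors on the same side of the center, whose depths differ by 1.
    by_cases hc : IsCentered s
    · left
      have h2 := congrArg Fin.val (show s.2 = s.1.rev from hc)
      rw [Fin.val_rev] at h2
      unfold depth
      omega
    · right
      have h2 := hA.generalPosition i s hs hc
      rw [IsCentered, Fin.ext_iff, Fin.val_rev] at hc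
      have hb := hps
      rw [Finset.mem_Icc, Fin.le_def, Fin.le_def] at hb
      obtain ⟨q, hq⟩ := (A.perm (i - 1)).surjective
        ⟨s.1 + s.2 - A.perm (i - 1) p, by omega⟩
      have hq' := congrArg Fin.val hq
      simp only at hq'
      have hqs : A.perm (i - 1) q ∈ Finset.Icc s.1 s.2 := by
        rw [Finset.mem_Icc, Fin.le_def, Fin.le_def]
        omega
      have e2 := A.perm_of_mem i s hs q hqs
      refine ⟨q, ?_, ⟨s, hs, hps, hqs⟩, ?_, ?_, ?_, ?_⟩
      · rintro rfl
        omega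
      · unfold depth; omega
      · unfold depth; omega
      · unfold depth; omega
      · rintro d ⟨hd, s', hs', h1', h2'⟩
        have hss : s ≠ s' := by
          rintro rfl
          omega
        have := lt_or_lt_of_disjoint_Icc l1 (A.switch_lt i s' hs')
          (A.switches_disjoint i s hs s' hs' hss)
        simp only [Fin.lt_def] at this
        unfold depth
        omega
  · push Not at hp
    left
    rw [depth, A.perm_of_notMem i p hp, depth]

theorem depth_eq_of_crosses (h : A.Crosses i d) (hp : A.depth (i - 1) p ≤ d) :
    A.depth i p = A.depth (i - 1) p := by
  rcases hA.depth_step i p with h1 | ⟨q, -, -, h1, h2, -, h3⟩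
  · exact h1
  · have := h3 d h
    omega

theorem depth_eq_of_crosses' (h : A.Crosses i d) (hp : A.depth i p ≤ d) :
    A.depth (i - 1) p = A.depth i p := by
  rcases hA.depth_step i p with h1 | ⟨q, -, -, h1, h2, -, h3⟩
  · exact h1.symm
  · have := h3 d h
    omega

theorem crosses_switch (h : A.Crosses i d) (hp : A.depth i p ≤ d) (hq : A.depth i q ≤ d) :
    A.Switch i p q :=
  h.switch (by rwa [hA.depth_eq_of_crosses' h hp]) (by rwa [hA.depth_eq_of_crosses' h hq])

/-- Points of the substring have just met and cannot meet again for 2n moves, so `unit_step_bound`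
applies: only outsiders can push them outward. -/
theorem depth_after (h : A.Crosses i d) {u : ℕ} (hu : u < 2 * n) (p : Fin (2 * n)) :
    (A.depth (i + u) p ≤ d - u → A.depth i p = A.depth (i + u) p) ∧
      (A.depth i p ≤ d → A.depth (i + u) p ≤ max (A.depth i p) (u - d + 2 * A.depth i p)) := by
  have := unit_step_bound (fun u p => A.depth (i + u) p) d (2 * n) ?_ u hu p
  · simp only [Nat.cast_zero, add_zero] at this
    exact ⟨this.1, this.2.2⟩
  · intro u hu p
    have := hA.depth_step (i + (u + 1 : ℕ)) p
    rw [show i + ((u + 1 : ℕ) : ℤ) - 1 = i + u by push_cast; ring] at this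
    rcases this with h1 | ⟨q, hpq, hs, h1, h2, h3, -⟩
    · exact Or.inl h1
    · refine Or.inr ⟨q, h1, by omega, ?_⟩
      simp only [Nat.cast_zero, add_zero]
      rintro ⟨h4, h5⟩
      have := (hA.crosses_switch h h4 h5).add_halfLength_le hpq hs (by omega)
      have := hA.halfLength_eq
      omega

/-- The time reversal of `depth_after`: points about to meet in the crossing have not met shortly
before. -/
theorem depth_before (h : A.Crosses i d) {u : ℕ} (hu : u < 2 * n) (p : Fin (2 * n)) :
    (A.depth (i - 1 - u) p ≤ d - u → A.depth (i - 1) p = A.depth (i - 1 - u) p) ∧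
      (A.depth (i - 1) p ≤ d →
        A.depth (i - 1 - u) p ≤ max (A.depth (i - 1) p) (u - d + 2 * A.depth (i - 1) p)) := by
  have := unit_step_bound (fun u p => A.depth (i - 1 - u) p) d (2 * n) ?_ u hu p
  · simp only [Nat.cast_zero, sub_zero] at this
    exact ⟨this.1, this.2.2⟩
  · intro u hu p
    have := hA.depth_step (i - 1 - u) p
    simp only [show i - 1 - ((u + 1 : ℕ) : ℤ) = i - 1 - u - 1 by push_cast; ring]
    rcases this with h1 | ⟨q, hpq, hs, h1, h2, h3, -⟩
    · exact Or.inl h1.symm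
    · refine Or.inr ⟨q, h2.symm, by omega, ?_⟩
      simp only [Nat.cast_zero, sub_zero]
      rintro ⟨h4, h5⟩
      have := hs.add_halfLength_le hpq (h.switch h4 h5) (by omega)
      have := hA.halfLength_eq
      omega

/-- Consecutive crossing moves leave time to dismantle a crossing substring and build the next. -/
theorem add_le_sub_of_crosses (h : A.Crosses i d) (h' : A.Crosses j e) (hij : i < j)
    (hj : j < i + (2 * n : ℕ)) : (d : ℤ) + e ≤ j - i := by
  by_contra! hlt
  have hd := h.1
  have he := h'.1
  -- With too small a gap, some time i + u is less than d moves after i and less than e moves before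
  -- j - 1. The point at depth 1 at that time lies in both crossing cores, and would meet its
  -- conjugate twice within a halfperiod.
  obtain ⟨u, hu⟩ := Int.eq_ofNat_of_zero_le (a := min (j - 1) (i + d - 1) - i) (by omega)
  obtain ⟨v, hv⟩ := Int.eq_ofNat_of_zero_le (a := j - 1 - (i + u)) (by omega)
  obtain ⟨p, hp, -⟩ := A.exists_depth_eq (i + u) (m := 1) le_rfl (by omega)
  have h1 := (hA.depth_after h (u := u) (by omega) p).1 (by omega)
  have h2 := (hA.depth_before h' (u := v) (by omega) p).1
  rw [show j - 1 - (v : ℤ) = i + u by omega] at h2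
  have h3 := h2 (by omega)
  have s1 := hA.crosses_switch h (p := p) (q := p.rev) (by omega) (by rw [hA.depth_rev]; omega)
  have s2 := (hA.switch_rev_iff h' (p := p)).2 (by omega)
  have := s1.add_halfLength_le (rev_ne p) s2 hij
  have := hA.halfLength_eq
  omega

theorem right_iff (h : A.Crosses i d) (hp : A.depth i p ≤ d) (h1 : i ≤ j)
    (h2 : j < i + (2 * n : ℕ)) : n ≤ (A.perm i p : ℕ) ↔ n ≤ (A.perm j p : ℕ) := by
  have := (hA.crosses_switch h (p := p.rev) (q := p) (by rwa [hA.depth_rev]) hp).perm_lt_iff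
    (rev_ne p).symm (l := i) (m := j) le_rfl (by have := A.halfLength_pos; omega) h1
    (by rwa [hA.halfLength_eq])
  simp only [hA.perm_rev, Fin.lt_def, Fin.val_rev] at this
  omega

/-- The d - r points of the substring beyond a point of depth r on its side keep their side and
order for the whole halfperiod, so room for them always remains outside it. -/
theorem depth_le_of_crosses (h : A.Crosses i d) (h1 : i ≤ j) (h2 : j < i + (2 * n : ℕ))
    (hp : A.depth i p ≤ d) : A.depth j p ≤ n - d + A.depth i p := by
  have hdn : d ≤ n := by
    obtain ⟨-, s, -, h1, -⟩ := h
    omega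
  have key : ∀ k : ℕ, ∀ p, A.depth i p + k = d → n ≤ (A.perm i p : ℕ) →
      A.depth j p ≤ n - k := by
    intro k
    induction k with
    | zero =>
      intro p _ _
      have := depth_le (A := A) (i := j) (p := p)
      simpa using this
    | succ k ih =>
      intro p hpk hpr
      push_cast at hpk
      have := one_le_depth (A := A) (i := i) (p := p)
      obtain ⟨q, hq, hqr⟩ := A.exists_depth_eq i (m := A.depth i p + 1) (by omega) (by omega)
      have h3 := ih q (by omega) hqr
      have hpq : p ≠ q := by
        rintro rfl
        omega
      have h4 := (hA.crosses_switch h (p := p) (q := q) (by omega) (by omega)).perm_lt_iff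
        hpq (l := i) (m := j) le_rfl (by have := A.halfLength_pos; omega) h1
        (by rwa [hA.halfLength_eq])
      have h5 := (hA.right_iff h (p := p) (by omega) h1 h2).1 hpr
      have h6 := (hA.right_iff h (p := q) (by omega) h1 h2).1 hqr
      simp only [Fin.lt_def] at h4
      unfold depth at *
      omega
  by_cases hr : n ≤ (A.perm i p : ℕ)
  · have := key (d - A.depth i p).toNat p (by omega) hr
    omega
  · have := key (d - A.depth i p).toNat p.rev (by rw [hA.depth_rev]; omega) (by
      rw [hA.perm_rev, Fin.val_rev]; omega)
    rw [hA.depth_rev] at this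
    omega

end IsSymmetricNearCritical
end Symmetric
end AllowableSequence

/-! ### Spacing of the crossing moves -/

/-- W k minus twice the sum of the D l with l < k is nondecreasing in k, and `h2` says that its last
value is at most its first. -/
theorem eq_add_two_mul_sum_of_le {t : ℕ} {W D : ℕ → ℤ}
    (h1 : ∀ k, k + 1 < t → W k + 2 * D k ≤ W (k + 1))
    (h2 : W (t - 1) + 2 * D (t - 1) ≤ W 0 + 2 * ∑ k ∈ Finset.range t, D k) {k : ℕ} (hk : k < t) :
    W k = W 0 + 2 * ∑ l ∈ Finset.range k, D l := by
  have key : ∀ m k, k + m < t → W k - 2 * ∑ l ∈ Finset.range k, D l ≤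
      W (k + m) - 2 * ∑ l ∈ Finset.range (k + m), D l := by
    intro m
    induction m with
    | zero => intro k _; simp
    | succ m ih =>
      intro k hk
      have := ih k (by omega)
      have := h1 (k + m) (by omega)
      rw [← add_assoc, Finset.sum_range_succ]
      linarith
  have e1 := key k 0 (by omega)
  have e2 := key (t - 1 - k) k (by omega)
  rw [show k + (t - 1 - k) = t - 1 by omega] at e2
  rw [show t = t - 1 + 1 by omega, Finset.sum_range_succ, Nat.add_sub_cancel] at h2
  simp at e1
  linarith

namespace AllowableSequence

variable {n t : ℕ} {A : AllowableSequence (2 * n)} {d : Fin t → ℕ}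

/-- The `k`-th crossing move. -/
noncomputable def crossingMove (A : AllowableSequence (2 * n)) (k : ℕ) : ℕ :=
  Nat.nth A.IsCrossingMove k

theorem finite_isCrossingMove (A : AllowableSequence (2 * n)) :
    (Set.ofPred A.IsCrossingMove).Finite :=
  (Set.finite_Icc 1 A.halfLength).subset fun _ h => h.1

theorem ncard_setOf_perm_mem_Icc (i : ℤ) {e : ℕ} {s : Fin (2 * n) × Fin (2 * n)}
    (h1 : (s.1 : ℕ) + e = n) (h2 : (s.2 : ℕ) + 1 = n + e) :
    {p | A.perm i p ∈ Finset.Icc s.1 s.2}.ncard = 2 * e := by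
  have : {p | A.perm i p ∈ Finset.Icc s.1 s.2} =
      ((Finset.Icc s.1 s.2).map (A.perm i).symm.toEmbedding : Set (Fin (2 * n))) := by
    ext p
    simp only [Set.mem_ofPred_eq, Finset.coe_map, Set.mem_image, Finset.mem_coe,
      Equiv.coe_toEmbedding]
    constructor
    · intro h
      exact ⟨_, h, by simp⟩
    · rintro ⟨x, hx, rfl⟩
      simpa using hx
  rw [this, Set.ncard_coe_finset, Finset.card_map, Fin.card_Icc]
  omega

namespace IsDCcsncgen

variable (hA : A.IsDCcsncgen d)
include hA

theorem card_isCrossingMove : A.finite_isCrossingMove.toFinset.card = t := by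
  rw [← Set.ncard_eq_toFinset_card _ A.finite_isCrossingMove]
  exact hA.signature.1

theorem isCrossingMove_crossingMove {k : ℕ} (hk : k < t) :
    A.IsCrossingMove (A.crossingMove k) :=
  Nat.nth_mem_of_lt_card A.finite_isCrossingMove (by rwa [hA.card_isCrossingMove])

theorem crossingMove_lt {k l : ℕ} (hkl : k < l) (hl : l < t) :
    A.crossingMove k < A.crossingMove l :=
  Nat.nth_lt_nth_of_lt_card A.finite_isCrossingMove hkl (by rwa [hA.card_isCrossingMove])

theorem exists_crossingMove_eq {m : ℕ} (hm : A.IsCrossingMove m) :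
    ∃ k : Fin t, A.crossingMove k = m := by
  obtain ⟨k, hk, rfl⟩ := Nat.exists_lt_card_finite_nth_eq A.finite_isCrossingMove hm
  rw [hA.card_isCrossingMove] at hk
  exact ⟨⟨k, hk⟩, rfl⟩

theorem crossingMove_pos (k : Fin t) : 1 ≤ A.crossingMove k :=
  (hA.isCrossingMove_crossingMove k.2).1.1

theorem crossingMove_le (k : Fin t) : A.crossingMove k ≤ 2 * n := by
  rw [← hA.isSymmetricNearCritical.halfLength_eq]
  exact (hA.isCrossingMove_crossingMove k.2).1.2

theorem crosses_and_substring (k : Fin t) : A.Crosses (A.crossingMove k) (d k) ∧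
    A.crossingSubstring k = {p | A.depth (A.crossingMove k - 1) p ≤ d k} := by
  obtain ⟨s, hs, hc⟩ := (hA.isCrossingMove_crossingMove k.2).2
  obtain ⟨e, he, h1, h2⟩ := exists_crosses_of_isCentered hs hc
  have hsub : A.crossingSubstring k =
      {p | A.perm (A.crossingMove k - 1) p ∈ Finset.Icc s.1 s.2} := by
    ext p
    constructor
    · rintro ⟨s', hs', hc', hp⟩
      obtain ⟨e', he', h1', h2'⟩ := exists_crosses_of_isCentered hs' hc'
      have hee := he.unique he'
      have : s = s' := by
        ext <;> omega
      subst this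
      exact hp
    · exact fun hp => ⟨s, hs, hc, hp⟩
  have hcard := hA.signature.2 k
  rw [hsub, ncard_setOf_perm_mem_Icc _ h1 h2] at hcard
  have hed : e = d k := by omega
  subst hed
  refine ⟨he, ?_⟩
  rw [hsub]
  ext p
  exact mem_Icc_iff_depth_le h1 h2

theorem crosses (k : Fin t) : A.Crosses (A.crossingMove k) (d k) := (hA.crosses_and_substring k).1

theorem mem_crossingSubstring_iff (k : Fin t) (p : Fin (2 * n)) :
    p ∈ A.crossingSubstring k ↔ A.depth (A.crossingMove k) p ≤ d k := by
  rw [(hA.crosses_and_substring k).2, Set.mem_ofPred_eq]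
  have hS := hA.isSymmetricNearCritical
  constructor <;> intro h
  · rwa [hS.depth_eq_of_crosses (hA.crosses k) h]
  · rwa [hS.depth_eq_of_crosses' (hA.crosses k) h]

theorem mem_crossingSubstring_iff_switch (k : Fin t) (p : Fin (2 * n)) :
    p ∈ A.crossingSubstring k ↔ A.Switch (A.crossingMove k) p p.rev := by
  rw [(hA.crosses_and_substring k).2, Set.mem_ofPred_eq,
    hA.isSymmetricNearCritical.switch_rev_iff (hA.crosses k)]

theorem exists_mem_crossingSubstring (p : Fin (2 * n)) :
    ∃ k : Fin t, p ∈ A.crossingSubstring k := by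
  have hS := hA.isSymmetricNearCritical
  obtain ⟨i, h1, h2, hs⟩ := A.exists_switch 0 (rev_ne p)
  obtain ⟨e, he, -⟩ := hS.exists_crosses_of_switch_rev hs
  obtain ⟨s, hs', hc, -⟩ := he.exists_isCentered
  lift i to ℕ using h1.le
  obtain ⟨k, hk⟩ := hA.exists_crossingMove_eq (m := i) ⟨⟨by omega, by omega⟩, s, hs', hc⟩
  refine ⟨k, ?_⟩
  rwa [hA.mem_crossingSubstring_iff_switch, hk]

theorem eq_of_mem_crossingSubstring {k l : Fin t} {p : Fin (2 * n)}
    (hk : p ∈ A.crossingSubstring k) (hl : p ∈ A.crossingSubstring l) : k = l := by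
  have hS := hA.isSymmetricNearCritical
  rw [hA.mem_crossingSubstring_iff_switch] at hk hl
  by_contra hne
  wlog hlt : k < l generalizing k l
  · exact this hl hk (Ne.symm hne) (lt_of_le_of_ne (not_lt.1 hlt) (Ne.symm hne))
  have h1 := hA.crossingMove_lt hlt l.2
  have h2 := hk.add_halfLength_le (rev_ne p) hl (by exact_mod_cast h1)
  have h3 := hA.crossingMove_le l
  have h4 := hA.crossingMove_pos k
  rw [hS.halfLength_eq] at h2
  omega

/-- Each point meets its conjugate exactly once in the halfperiod, so the crossing substrings
partition the 2n points. -/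
theorem sum_signature : ∑ k, d k = n := by
  classical
  choose c hc using hA.exists_mem_crossingSubstring
  have h1 := Finset.card_eq_sum_card_fiberwise (f := c) (s := Finset.univ) (t := Finset.univ)
    (fun _ _ => Finset.mem_univ _)
  have h2 : ∀ k : Fin t, (Finset.univ.filter fun p => c p = k).card = 2 * d k := by
    intro k
    rw [← hA.signature.2 k, ← Set.ncard_coe_finset]
    congr 1
    ext p
    simp only [Finset.coe_filter, Finset.mem_univ, true_and, Set.mem_ofPred_eq]
    exact ⟨fun h => h ▸ hc p, fun h => hA.eq_of_mem_crossingSubstring (hc p) h⟩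
  simp only [h2, Finset.card_univ, Fintype.card_fin, ← Finset.mul_sum] at h1
  omega

/-- Around the cycle the gaps are at least the sums of neighboring sizes, and these lower bounds
already add up to 2n, the sum of the gaps. So each gap is the sum of its two sizes; only the parity
is kept. -/
theorem exists_parity : ∃ c : ℤ, ∀ k : Fin t, (2 : ℤ) ∣ A.crossingMove k - d k - c := by
  have hS := hA.isSymmetricNearCritical
  rcases Nat.eq_zero_or_pos t with rfl | ht
  · exact ⟨0, fun k => k.elim0⟩
  set D : ℕ → ℤ := fun k => if h : k < t then (d ⟨k, h⟩ : ℤ) else 0 with hD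
  have hDk : ∀ {k : ℕ} (h : k < t), D k = d ⟨k, h⟩ := fun h => by simp [hD, h]
  have hsum : ∑ k ∈ Finset.range t, D k = n := by
    rw [Finset.sum_range, ← hA.sum_signature]
    push_cast
    exact Finset.sum_congr rfl fun k _ => hDk k.2
  have key : ∀ k : ℕ, k < t → _ := fun k hk =>
    eq_add_two_mul_sum_of_le (t := t) (W := fun k => (A.crossingMove k : ℤ) - D k) (D := D) (k := k)
      ?_ ?_ hk
  · refine ⟨A.crossingMove 0 - D 0, fun k => ?_⟩
    have := key k k.2
    simp only [hDk k.2, Fin.eta] at this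
    rw [this]
    exact ⟨∑ l ∈ Finset.range k, D l, by ring⟩
  · intro k hk
    have h1 := hS.add_le_sub_of_crosses (hA.crosses ⟨k, by omega⟩) (hA.crosses ⟨k + 1, hk⟩)
      (by exact_mod_cast hA.crossingMove_lt (Nat.lt_succ_self k) hk) (by
        have := hA.crossingMove_le ⟨k + 1, hk⟩
        have := hA.crossingMove_pos ⟨k, by omega⟩
        simp only at *
        omega)
    simp only [hDk hk, hDk (show k < t by omega)] at h1 ⊢
    linarith
  · have h1 := hS.crosses_add (hA.crosses ⟨0, ht⟩)
    have h2 := hA.crosses ⟨t - 1, by omega⟩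
    have h3 := hA.crossingMove_le ⟨t - 1, by omega⟩
    have h4 := hA.crossingMove_pos ⟨0, ht⟩
    have h5 : A.crossingMove 0 ≤ A.crossingMove (t - 1) := by
      rcases Nat.eq_zero_or_pos (t - 1) with h | h
      · rw [h]
      · exact (hA.crossingMove_lt h (by omega)).le
    simp only at h1 h2 h3 h4
    rw [hsum, hDk ht, hDk (show t - 1 < t by omega)]
    rcases h5.lt_or_eq with h5 | h5
    · have := hS.add_le_sub_of_crosses h2 h1 (by omega) (by omega)
      push_cast at this ⊢
      linarith
    · rw [← h5] at h2 ⊢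
      have h6 := h2.unique (hA.crosses ⟨0, ht⟩)
      obtain ⟨-, s, -, h7, -⟩ := h2
      omega

theorem exists_parity_crosses : ∃ c : ℤ, ∀ (i : ℤ) e, -(2 * n : ℤ) < i → i ≤ 2 * n → A.Crosses i e →
    (2 : ℤ) ∣ i - e - c := by
  have hS := hA.isSymmetricNearCritical
  obtain ⟨c, hc⟩ := hA.exists_parity
  have key : ∀ (i : ℤ) e, 0 < i → i ≤ 2 * n → A.Crosses i e → (2 : ℤ) ∣ i - e - c := by
    intro i e h1 h2 he
    obtain ⟨s, hs, hcs, -⟩ := he.exists_isCentered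
    lift i to ℕ using h1.le
    have := hS.halfLength_eq
    obtain ⟨k, hk⟩ := hA.exists_crossingMove_eq (m := i) ⟨⟨by omega, by omega⟩, s, hs, hcs⟩
    have h3 := hA.crosses k
    rw [hk] at h3
    rw [he.unique h3, ← hk]
    exact hc k
  refine ⟨c, fun i e h1 h2 he => ?_⟩
  by_cases h3 : 0 < i
  · exact key i e h3 h2 he
  · have := key _ e (by push_cast; omega) (by push_cast; omega) (hS.crosses_add he)
    push_cast at this
    omega

end IsDCcsncgen

/-! ### Exact depths between crossings -/

/-- The depth after `T` moves of a point that is at depth `r` when the crossing switch of the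
`i`-th move reverses `2 * d` points including it. -/
def depthFormula (n : ℕ) (i : ℤ) (d : ℕ) (r T : ℤ) : ℤ :=
  min (min (max r (T - i - d + 2 * r)) (n - d + r)) (max r (i + 2 * n - 1 - T - d + 2 * r))

/-- Two points both on their way out, or both on their way in, are separated by the gaps `h1`. For
one going out and one coming in, `h3` makes the difference of the two linear expressions odd. -/
theorem depthFormula_ne {i j T r s : ℤ} {d e : ℕ} (hij : i < j) (hjT : j ≤ T)
    (hT : T < i + 2 * n) (h1 : (d : ℤ) + e ≤ j - i) (h2 : (d : ℤ) + e ≤ i + 2 * n - j)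
    (h3 : (2 : ℤ) ∣ (j - e) - (i - d)) (hr : 1 ≤ r) (hrd : r ≤ d) (hs : 1 ≤ s) (hse : s ≤ e) :
    depthFormula n i d r T ≠ depthFormula n j e s T := by
  unfold depthFormula
  omega

namespace IsSymmetricNearCritical

variable (hA : A.IsSymmetricNearCritical)
include hA

theorem crosses_sub {i : ℤ} {e : ℕ} (h : A.Crosses i e) : A.Crosses (i - (2 * n : ℕ)) e := by
  have hen : 1 ≤ e ∧ e ≤ n := by
    obtain ⟨h0, s, -, h1, -⟩ := h
    omega
  obtain ⟨p, hp, -⟩ := A.exists_depth_eq (i - 1) (m := e) (by omega) (by omega)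
  have hs := ((hA.switch_rev_iff h).2 hp.le).sub_halfLength (rev_ne p)
  rw [hA.halfLength_eq] at hs
  obtain ⟨e', he', -⟩ := hA.exists_crosses_of_switch_rev hs
  have := hA.crosses_add he'
  rw [sub_add_cancel] at this
  rwa [h.unique this]

/-- Combines three limits: the speed after the crossing at i, the room needed outside, and the speed
before the repeated crossing at i + 2n. -/
theorem depth_le_formula {i T : ℤ} {e : ℕ} (h : A.Crosses i e) {p : Fin (2 * n)}
    (hp : A.depth i p ≤ e) (h1 : i ≤ T) (h2 : T < i + 2 * n) :
    A.depth T p ≤ depthFormula n i e (A.depth i p) T := by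
  have hr := hA.depth_eq_of_crosses' h hp
  obtain ⟨u, hu⟩ := Int.eq_ofNat_of_zero_le (a := T - i) (by omega)
  obtain ⟨v, hv⟩ := Int.eq_ofNat_of_zero_le (a := i + 2 * n - 1 - T) (by omega)
  have e1 := (hA.depth_after h (u := u) (by omega) p).2 hp
  have e2 := hA.depth_le_of_crosses h h1 (by push_cast; omega) hp
  have e3 := (hA.depth_before (hA.crosses_add h) (u := v) (by omega) p).2
  have e4 : A.depth (i + (2 * n : ℕ) - 1) p = A.depth (i - 1) p := by
    rw [← depth_add_halfLength (i := i - 1), hA.halfLength_eq]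
    congr 1
    ring
  rw [e4, hr, show i + ((2 * n : ℕ) : ℤ) - 1 - v = T by push_cast; omega] at e3
  rw [show i + (u : ℤ) = T by omega] at e1
  have e5 := e3 hp
  unfold depthFormula
  omega

end IsSymmetricNearCritical

/-- Both functions map S bijectively onto {1, …, n}, so they have equal sums, and a termwise
inequality with equal sums is an equality. -/
theorem eq_of_le_of_injOn {α : Type*} {S : Finset α} {f g : α → ℤ} {n : ℕ} (hS : S.card = n)
    (hf : Set.InjOn f S) (hg : Set.InjOn g S) (hf1 : ∀ x ∈ S, 1 ≤ f x)
    (hfg : ∀ x ∈ S, f x ≤ g x) (hgn : ∀ x ∈ S, g x ≤ n) : ∀ x ∈ S, f x = g x := by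
  classical
  have key : ∀ F : α → ℤ, Set.InjOn F S → (∀ x ∈ S, 1 ≤ F x) → (∀ x ∈ S, F x ≤ n) →
      ∑ x ∈ S, F x = ∑ m ∈ Finset.Icc (1 : ℤ) n, m := by
    intro F hF h1 h2
    rw [← Finset.sum_image (f := fun m : ℤ => m) hF]
    congr 1
    refine Finset.eq_of_subset_of_card_le ?_ ?_
    · intro m hm
      obtain ⟨x, hx, rfl⟩ := Finset.mem_image.1 hm
      exact Finset.mem_Icc.2 ⟨h1 x hx, h2 x hx⟩
    · rw [Finset.card_image_of_injOn hF, hS]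
      simp
  exact (Finset.sum_eq_sum_iff_of_le hfg).1 ((key f hf hf1 fun x hx => (hfg x hx).trans (hgn x hx)).trans
    (key g hg (fun x hx => (hf1 x hx).trans (hfg x hx)) hgn).symm)

namespace IsDCcsncgen

variable (hA : A.IsDCcsncgen d)
include hA

/-- The upper bounds for the depths of the points are attained. -/
theorem depth_eq_formula {i T : ℤ} {e : ℕ} (h : A.Crosses i e) {p : Fin (2 * n)}
    (hp : A.depth i p ≤ e) (h1 : i ≤ T) (h2 : T < i + 2 * n) (hT0 : 0 ≤ T) (hT : T ≤ 2 * n) :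
    A.depth T p = depthFormula n i e (A.depth i p) T := by
  classical
  have hS := hA.isSymmetricNearCritical
  have hlen := hS.halfLength_eq
  wlog hpr : n ≤ (A.perm T p : ℕ) generalizing p
  · rw [← hS.depth_rev, ← hS.depth_rev (i := i)]
    refine this (by rwa [hS.depth_rev]) ?_
    rw [hS.perm_rev, Fin.val_rev]
    omega
  obtain ⟨c, hc⟩ := hA.exists_parity_crosses
  -- Each q is assigned the crossing in which it met its conjugate during the last 2n moves up to T.
  -- This move may have a nonpositive index.
  have hlast : ∀ q : Fin (2 * n), ∃ j e, A.Crosses j e ∧ A.depth j q ≤ e ∧ j ≤ T ∧ T < j + 2 * n := by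
    intro q
    obtain ⟨j, hj1, hj2, hj⟩ := A.exists_switch (T - 2 * n) (rev_ne q)
    obtain ⟨e, he, hq⟩ := hS.exists_crosses_of_switch_rev hj
    exact ⟨j, e, he, by rwa [hS.depth_eq_of_crosses he hq], by omega, by omega⟩
  choose τ δ hτ hδ hτ1 hτ2 using hlast
  have hτp : τ p = i ∧ δ p = e := by
    have s1 := hS.crosses_switch (hτ p) (hδ p) (q := p.rev) (by rw [hS.depth_rev]; exact hδ p)
    have s2 := hS.crosses_switch h hp (q := p.rev) (by rwa [hS.depth_rev])
    have heq : τ p = i := by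
      rcases lt_trichotomy (τ p) i with hlt | heq | hlt
      · have := s1.add_halfLength_le (rev_ne p) s2 hlt
        have := hτ2 p
        omega
      · exact heq
      · have := s2.add_halfLength_le (rev_ne p) s1 hlt
        have := hτ1 p
        omega
    refine ⟨heq, ?_⟩
    have := hτ p
    rw [heq] at this
    exact this.unique h
  have hne : ∀ q q', τ q < τ q' → depthFormula n (τ q) (δ q) (A.depth (τ q) q) T ≠
      depthFormula n (τ q') (δ q') (A.depth (τ q') q') T := by
    intro q q' hlt
    have a1 := hτ1 q
    have a2 := hτ2 q
    have a3 := hτ1 q'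
    have a4 := hτ2 q'
    have b1 := hS.add_le_sub_of_crosses (hτ q) (hτ q') hlt (by push_cast; omega)
    have b2 := hS.add_le_sub_of_crosses (hτ q') (hS.crosses_add (hτ q)) (by push_cast; omega)
      (by push_cast; omega)
    push_cast at b2
    have b3 := hc _ _ (by omega) (by omega) (hτ q)
    have b4 := hc _ _ (by omega) (by omega) (hτ q')
    exact depthFormula_ne hlt a3 a2 b1 (by omega) (by omega) one_le_depth (hδ q) one_le_depth (hδ q')
  have key := eq_of_le_of_injOn (S := Finset.univ.filter fun q => n ≤ (A.perm T q : ℕ)) (n := n)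
    (f := fun q => A.depth T q) (g := fun q => depthFormula n (τ q) (δ q) (A.depth (τ q) q) T)
    ?_ ?_ ?_ (fun _ _ => one_le_depth)
    (fun q _ => hS.depth_le_formula (hτ q) (hδ q) (hτ1 q) (hτ2 q)) ?_ p (by simpa using hpr)
  · rw [hτp.1, hτp.2] at key
    exact key
  · have : (Finset.univ.filter fun q => n ≤ (A.perm T q : ℕ)) =
        (Finset.univ.filter fun x : Fin (2 * n) => n ≤ (x : ℕ)).map (A.perm T).symm.toEmbedding := by
      ext q
      simp only [Finset.mem_filter, Finset.mem_univ, true_and, Finset.mem_map_equiv,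
        Equiv.symm_symm]
    rw [this, Finset.card_map]
    have h3 : (Finset.univ.filter fun x : Fin (2 * n) => n ≤ (x : ℕ)).card =
        (Finset.univ.filter fun x : Fin (2 * n) => ¬ n ≤ (x : ℕ)).card := by
      refine Finset.card_bij' (fun x _ => x.rev) (fun x _ => x.rev) ?_ ?_ ?_ ?_
      · intro x hx
        simp only [Finset.mem_filter, Finset.mem_univ, true_and, Fin.val_rev] at *
        omega
      · intro x hx
        simp only [Finset.mem_filter, Finset.mem_univ, true_and, Fin.val_rev] at *
        omega
      · simp
      · simp
    have h4 := Finset.card_filter_add_card_filter_not (s := (Finset.univ : Finset (Fin (2 * n))))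
      (fun x : Fin (2 * n) => n ≤ (x : ℕ))
    rw [Finset.card_univ, Fintype.card_fin] at h4
    omega
  · intro q hq q' hq' hqq
    simp only [Finset.coe_filter, Finset.mem_univ, true_and, Set.mem_ofPred_eq] at hq hq'
    exact eq_of_depth_eq hq hq' hqq
  · intro q hq q' hq' hqq
    simp only [Finset.coe_filter, Finset.mem_univ, true_and, Set.mem_ofPred_eq] at hq hq'
    rcases lt_trichotomy (τ q) (τ q') with hlt | heq | hlt
    · exact absurd hqq (hne q q' hlt)
    -- For a common crossing the formula is strictly increasing in the depth, and both points were
    -- already on the right side there.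
    · have c1 := hτ q
      have c2 := hτ q'
      rw [← heq] at c2
      have hde := c1.unique c2
      have d1 := (hS.right_iff c1 (hδ q) (hτ1 q) (by have := hτ2 q; push_cast; omega)).2 hq
      have d2 := (hS.right_iff c2 (p := q') (by have := hδ q'; rwa [heq])
        (hτ1 q) (by have := hτ2 q; push_cast; omega)).2 hq'
      refine eq_of_depth_eq d1 d2 ?_
      simp only [← heq, ← hde, depthFormula] at hqq
      omega
    · exact absurd hqq.symm (hne q' q hlt)
  · intro q _
    have := hδ q
    unfold depthFormula
    omega

/-- The move in which a point of one crossing substring and a point of another one meet depends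
only on the difference of their depths. -/
theorem switch_of_crossingMove_lt {k l : Fin t} (hkl : k < l) {p q : Fin (2 * n)}
    (hp : p ∈ A.crossingSubstring k) (hq : q ∈ A.crossingSubstring l)
    (hpr : n ≤ (A.perm (A.crossingMove k) p : ℕ))
    (hqr : n ≤ (A.perm (A.crossingMove l - 2 * n) q : ℕ)) {m : ℤ}
    (hm : 2 * m = A.crossingMove k + A.crossingMove l + d k - d l +
      2 * (A.depth (A.crossingMove l) q - A.depth (A.crossingMove k) p)) :
    A.Switch m p q := by
  have hS := hA.isSymmetricNearCritical
  have hlen := hS.halfLength_eq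
  rw [hA.mem_crossingSubstring_iff] at hp hq
  have ck := hA.crosses k
  have cl := hA.crosses l
  have cl' := hS.crosses_sub cl
  have hql : A.depth (A.crossingMove l - (2 * n : ℕ)) q = A.depth (A.crossingMove l) q := by
    rw [← hlen, depth_sub_halfLength]
  have hlt := hA.crossingMove_lt hkl l.2
  have h1 := hA.crossingMove_pos k
  have h2 := hA.crossingMove_le l
  have b1 := hS.add_le_sub_of_crosses ck cl (by omega) (by omega)
  have b2 := hS.add_le_sub_of_crosses cl' ck (by push_cast; omega) (by push_cast; omega)
  push_cast at b2 hql cl'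
  have r1 := one_le_depth (A := A) (i := A.crossingMove k) (p := p)
  have r2 := one_le_depth (A := A) (i := A.crossingMove l) (p := q)
  have p0 := hA.depth_eq_formula ck hp (T := m - 1) (by omega) (by omega) (by omega) (by omega)
  have p1 := hA.depth_eq_formula ck hp (T := m) (by omega) (by omega) (by omega) (by omega)
  have q0 := hA.depth_eq_formula cl' (p := q) (by omega) (T := m - 1) (by omega) (by omega)
    (by omega) (by omega)
  have q1 := hA.depth_eq_formula cl' (p := q) (by omega) (T := m) (by omega) (by omega)
    (by omega) (by omega)
  have p2 := (hS.right_iff ck hp (j := m - 1) (by omega) (by push_cast; omega)).1 hpr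
  have p3 := (hS.right_iff ck hp (j := m) (by omega) (by push_cast; omega)).1 hpr
  have q2 := (hS.right_iff cl' (p := q) (by omega) (j := m - 1) (by omega)
    (by push_cast; omega)).1 hqr
  have q3 := (hS.right_iff cl' (p := q) (by omega) (j := m) (by omega)
    (by push_cast; omega)).1 hqr
  rw [hql] at q0 q1
  by_contra hn
  have := perm_lt_iff_of_not_switch hn
  simp only [Fin.lt_def] at this
  -- Around move m, p is on its way out and q on its way in, both at unit speed. The chosen m makes
  -- depth q - depth p equal to 1 before the move and -1 after it.
  have p0' : A.depth (m - 1) p = m - 1 - A.crossingMove k - d k + 2 * A.depth (A.crossingMove k) p := by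
    rw [p0, depthFormula]; omega
  have p1' : A.depth m p = m - A.crossingMove k - d k + 2 * A.depth (A.crossingMove k) p := by
    rw [p1, depthFormula]; omega
  have q0' : A.depth (m - 1) q = A.crossingMove l - m - d l + 2 * A.depth (A.crossingMove l) q := by
    rw [q0, depthFormula]; omega
  have q1' : A.depth m q = A.crossingMove l - 1 - m - d l + 2 * A.depth (A.crossingMove l) q := by
    rw [q1, depthFormula]; omega
  clear p0 p1 q0 q1
  unfold depth at p0' p1' q0' q1' hm
  omega

end IsDCcsncgen
end AllowableSequence

/-! ### Plane geometry -/

/-- The determinant of two vectors of the plane. -/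
def planeDet (v w : Plane) : ℝ := v 0 * w 1 - v 1 * w 0

theorem plane_ext {v w : Plane} (h0 : v 0 = w 0) (h1 : v 1 = w 1) : v = w := by
  ext i
  fin_cases i
  · exact h0
  · exact h1

theorem plane_inner (v w : Plane) : inner ℝ v w = v 0 * w 0 + v 1 * w 1 := by
  rw [PiLp.inner_apply, Fin.sum_univ_two]
  simp [mul_comm]

theorem inner_unitVec (v : Plane) (φ : ℝ) :
    inner ℝ v (unitVec φ) = v 0 * Real.cos φ + v 1 * Real.sin φ := by
  rw [plane_inner]
  simp [unitVec]

theorem planeDet_eq_zero_of_inner {u v w : Plane} (hu : u ≠ 0) (hv : inner ℝ v u = 0)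
    (hw : inner ℝ w u = 0) : planeDet v w = 0 := by
  rw [plane_inner] at hv hw
  unfold planeDet
  by_contra hne
  have h0 : (v 0 * w 1 - v 1 * w 0) * u 0 = 0 := by linear_combination w 1 * hv - v 1 * hw
  have h1 : (v 0 * w 1 - v 1 * w 0) * u 1 = 0 := by linear_combination v 0 * hw - w 0 * hv
  exact hu (plane_ext ((mul_eq_zero.1 h0).resolve_left hne) ((mul_eq_zero.1 h1).resolve_left hne))

theorem exists_smul_of_planeDet {v w : Plane} (hv : v ≠ 0) (h : planeDet v w = 0) :
    ∃ a : ℝ, w = a • v := by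
  unfold planeDet at h
  by_cases h0 : v 0 = 0
  · have h1 : v 1 ≠ 0 := fun h1 => hv (plane_ext h0 h1)
    refine ⟨w 1 / v 1, plane_ext ?_ ?_⟩
    · rw [h0] at h
      have : w 0 = 0 := (mul_eq_zero.1 (by linear_combination -h : v 1 * w 0 = 0)).resolve_left h1
      simp [this, h0]
    · simp [h1]
  · refine ⟨w 0 / v 0, plane_ext ?_ ?_⟩
    · simp [h0]
    · simp only [PiLp.smul_apply, smul_eq_mul]
      field_simp
      linear_combination h

/-- The points x, y, x', y' form a parallelogram, nondegenerate by `h3`, so its diagonals bisect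
each other. -/
theorem add_eq_add_of_parallel {x x' y y' : Plane} (h1 : planeDet (x - y) (x' - y') = 0)
    (h2 : planeDet (x - y') (x' - y) = 0) (h3 : planeDet (x - x') (y - y') ≠ 0) :
    x + x' = y + y' := by
  simp only [planeDet, PiLp.sub_apply] at h1 h2 h3
  refine plane_ext (mul_right_cancel₀ h3 ?_) (mul_right_cancel₀ h3 ?_) <;>
    simp only [PiLp.add_apply]
  · linear_combination (x 0 - x' 0 + y 0 - y' 0) * h1 + (y 0 - y' 0 - x 0 + x' 0) * h2
  · linear_combination (x 1 - x' 1 + y 1 - y' 1) * h1 + (y 1 - y' 1 - x 1 + x' 1) * h2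

theorem exists_affineEquiv_of_planeDet (o : Plane) {v w : Plane} (h : planeDet v w ≠ 0) :
    ∃ f : Plane ≃ᵃ[ℝ] Plane, ∀ a b : ℝ, f (o + a • v + b • w) = !₂[a, b] := by
  let M : Plane →ₗ[ℝ] Plane :=
    { toFun := fun z => z 0 • v + z 1 • w
      map_add' := fun z z' => by simp only [PiLp.add_apply]; module
      map_smul' := fun c z => by
        simp only [PiLp.smul_apply, smul_eq_mul, RingHom.id_apply]; module }
  have hM : Function.Injective M := by
    rw [injective_iff_map_eq_zero]
    intro z hz
    have h0 := congrArg (fun z : Plane => z 0) hz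
    have h1 := congrArg (fun z : Plane => z 1) hz
    simp only [M, LinearMap.coe_mk, AddHom.coe_mk, PiLp.add_apply, PiLp.smul_apply, smul_eq_mul,
      PiLp.zero_apply] at h0 h1
    unfold planeDet at h
    refine plane_ext (mul_right_cancel₀ h ?_) (mul_right_cancel₀ h ?_) <;>
      simp only [PiLp.zero_apply, zero_mul]
    · linear_combination w 1 * h0 - w 0 * h1
    · linear_combination v 0 * h1 - v 1 * h0
  let g : Plane ≃ᵃ[ℝ] Plane :=
    (LinearEquiv.ofInjectiveEndo M hM).toAffineEquiv.trans (AffineEquiv.constVAdd ℝ Plane o)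
  refine ⟨g.symm, fun a b => ?_⟩
  rw [AffineEquiv.symm_apply_eq]
  simp [g, M, add_assoc]

/-- The set of the points `o ± l ^ r • v` for `0 ≤ r ≤ s`. -/
def expPencil (l : ℝ) (o v : Plane) (s : ℕ) : Set Plane :=
  {x | ∃ r ≤ s, x = o + l ^ r • v ∨ x = o - l ^ r • v}

theorem affinelyEquivalent_expCrossStar {l : ℝ} {o v w : Plane} (h : planeDet v w ≠ 0) (s t : ℕ) :
    AffinelyEquivalent (expPencil l o v s ∪ expPencil l o w t) (expCrossStar l s t) := by
  obtain ⟨f, hf⟩ := exists_affineEquiv_of_planeDet o h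
  have f1 : ∀ a : ℝ, f (o + a • v) = !₂[a, 0] := fun a => by simpa using hf a 0
  have f2 : ∀ a : ℝ, f (o - a • v) = !₂[-a, 0] := fun a => by
    rw [sub_eq_add_neg, ← neg_smul, f1]
  have f3 : ∀ b : ℝ, f (o + b • w) = !₂[0, b] := fun b => by simpa using hf 0 b
  have f4 : ∀ b : ℝ, f (o - b • w) = !₂[0, -b] := fun b => by
    rw [sub_eq_add_neg, ← neg_smul, f3]
  refine ⟨f, ?_⟩
  rw [Set.image_union, expCrossStar]
  congr 1
  · ext x
    constructor
    · rintro ⟨_, ⟨r, hr, rfl | rfl⟩, rfl⟩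
      · exact ⟨r, hr, Or.inl (f1 _)⟩
      · exact ⟨r, hr, Or.inr (f2 _)⟩
    · rintro ⟨r, hr, rfl | rfl⟩
      · exact ⟨_, ⟨r, hr, Or.inl rfl⟩, f1 _⟩
      · exact ⟨_, ⟨r, hr, Or.inr rfl⟩, f2 _⟩
  · ext x
    constructor
    · rintro ⟨_, ⟨r, hr, rfl | rfl⟩, rfl⟩
      · exact ⟨r, hr, Or.inl (f3 _)⟩
      · exact ⟨r, hr, Or.inr (f4 _)⟩
    · rintro ⟨r, hr, rfl | rfl⟩
      · exact ⟨_, ⟨r, hr, Or.inl rfl⟩, f3 _⟩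
      · exact ⟨_, ⟨r, hr, Or.inr rfl⟩, f4 _⟩

/-- As a function of the angle the projection is K sin(φ - θ) with K ≠ 0, which changes sign at θ
and has no other zero within distance 1 < π. -/
theorem mul_neg_of_inner_unitVec_eq_zero {v : Plane} (hv : v ≠ 0) {θ x y : ℝ}
    (h : inner ℝ v (unitVec θ) = 0) (hxy : x * y < 0) (hx : |x| < 1) (hy : |y| < 1) :
    inner ℝ v (unitVec (θ + x)) * inner ℝ v (unitVec (θ + y)) < 0 := by
  set K := v 1 * Real.cos θ - v 0 * Real.sin θ with hK
  rw [inner_unitVec] at h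
  have key : ∀ z, inner ℝ v (unitVec (θ + z)) = K * Real.sin z := fun z => by
    rw [inner_unitVec, Real.cos_add, Real.sin_add]
    linear_combination Real.cos z * h
  have hK0 : K ≠ 0 := by
    intro h0
    have hsc := Real.sin_sq_add_cos_sq θ
    refine hv (plane_ext ?_ ?_) <;> simp only [PiLp.zero_apply]
    · linear_combination Real.cos θ * h - Real.sin θ * (hK.symm.trans h0) - v 0 * hsc
    · linear_combination Real.sin θ * h + Real.cos θ * (hK.symm.trans h0) - v 1 * hsc
  have hsin : Real.sin x * Real.sin y < 0 := by
    have hpi := Real.pi_gt_three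
    rw [abs_lt] at hx hy
    rcases mul_neg_iff.1 hxy with ⟨h1, h2⟩ | ⟨h1, h2⟩
    · exact mul_neg_of_pos_of_neg (Real.sin_pos_of_pos_of_lt_pi h1 (by linarith))
        (Real.sin_neg_of_neg_of_neg_pi_lt h2 (by linarith))
    · exact mul_neg_of_neg_of_pos (Real.sin_neg_of_neg_of_neg_pi_lt h1 (by linarith))
        (Real.sin_pos_of_pos_of_lt_pi h2 (by linarith))
  rw [key, key]
  have : 0 < K ^ 2 := by positivity
  nlinarith

theorem add_mul_mem_uIoo {a b ε : ℝ} (hab : a ≠ b) (h0 : 0 < ε) (h1 : ε < 1) :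
    a + ε * (b - a) ∈ Set.uIoo a b := by
  rcases hab.lt_or_gt with h | h
  · rw [Set.uIoo_of_lt h]
    constructor <;> nlinarith
  · rw [Set.uIoo_of_gt h]
    constructor <;> nlinarith

theorem inner_unitVec_nonneg_of_forall_uIoo {v : Plane} {a b : ℝ} (hab : a ≠ b)
    (h : ∀ φ ∈ Set.uIoo a b, 0 ≤ inner ℝ v (unitVec φ)) : 0 ≤ inner ℝ v (unitVec a) := by
  have hc : Continuous fun ε : ℝ => inner ℝ v (unitVec (a + ε * (b - a))) := by
    simp only [inner_unitVec]
    fun_prop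
  have ht := (hc.tendsto 0).mono_left (nhdsWithin_le_nhds (s := Set.Ioi 0))
  simp only [zero_mul, add_zero] at ht
  refine ge_of_tendsto ht ?_
  filter_upwards [Ioo_mem_nhdsGT (zero_lt_one' ℝ)] with ε hε
  exact h _ (add_mul_mem_uIoo hab hε.1 hε.2)

/-! ### Geometry of a realization -/

namespace IsGeometricRealization

open AllowableSequence

/-- The directions `u i` in which points meet in the `i`-th move and, between these, directions
`v i` in which the order of the projections is the `i`-th permutation. -/
theorem exists_directions {N : ℕ} {A : AllowableSequence N} {P : Fin N → Plane}
    (hP : IsGeometricRealization A P) : ∃ u v : ℤ → Plane, (∀ i, u i ≠ 0) ∧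
      (∀ i p q, p ≠ q → (inner ℝ (P p - P q) (u i) = 0 ↔ A.Switch i p q)) ∧
      ∀ i p q, A.perm i p < A.perm i q → 0 < inner ℝ (P q - P p) (v i) := by
  obtain ⟨hinj, θ, hθ, -, hord⟩ := hP
  have hpos : ∀ i p q, A.perm i p < A.perm i q → ∀ φ ∈ Set.uIoo (θ i) (θ (i + 1)),
      0 < inner ℝ (P q - P p) (unitVec φ) := by
    intro i p q h φ hφ
    have := (hord i φ hφ p q).2 h
    rw [inner_sub_left]
    linarith
  have hpos' : ∀ i p q, A.perm (i - 1) p < A.perm (i - 1) q → ∀ φ ∈ Set.uIoo (θ i) (θ (i - 1)),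
      0 < inner ℝ (P q - P p) (unitVec φ) := by
    intro i p q h φ hφ
    refine hpos (i - 1) p q h φ ?_
    rwa [sub_add_cancel, Set.uIoo_comm]
  have hsgn : ∀ i, 0 < (θ (i + 1) - θ i) * (θ i - θ (i - 1)) := by
    intro i
    rcases hθ with h | h
    · have h1 := h (show i < i + 1 by omega)
      have h2 := h (show i - 1 < i by omega)
      nlinarith
    · have h1 := h (show i < i + 1 by omega)
      have h2 := h (show i - 1 < i by omega)
      nlinarith
  have hne : ∀ i, θ i ≠ θ (i + 1) := fun i h => by have := hsgn i; simp [h] at this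
  have hne' : ∀ i, θ i ≠ θ (i - 1) := fun i h => by have := hsgn i; simp [← h] at this
  refine ⟨fun i => unitVec (θ i), fun i => unitVec (θ i + 1 / 2 * (θ (i + 1) - θ i)), ?_, ?_, ?_⟩
  · intro i h
    have h0 := congrArg (fun z : Plane => z 0) h
    have h1 := congrArg (fun z : Plane => z 1) h
    simp only [unitVec, PiLp.zero_apply] at h0 h1
    have h0' : Real.cos (θ i) = 0 := h0
    have h1' : Real.sin (θ i) = 0 := h1
    have := Real.sin_sq_add_cos_sq (θ i)
    rw [h0', h1'] at this
    norm_num at this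
  · intro i p q hpq
    wlog hlt : A.perm (i - 1) p < A.perm (i - 1) q generalizing p q
    · have := this q p hpq.symm
        (lt_of_le_of_ne (not_lt.1 hlt) fun he => hpq.symm ((A.perm (i - 1)).injective he))
      rw [← neg_sub, inner_neg_left, neg_eq_zero, this]
      exact ⟨fun h => h.symm, fun h => h.symm⟩
    constructor
    -- A tie is a simple zero of the projected difference, so the order of p and q flips there,
    -- contradicting the absence of a switch.
    · intro h0
      by_contra hn
      have hlt' := perm_lt_of_not_switch hn hlt
      have hv : P p - P q ≠ 0 := sub_ne_zero.2 fun h => hpq (hinj h)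
      set a := θ (i + 1) - θ i with ha
      set b := θ (i - 1) - θ i with hb
      have hab : a * b < 0 := by
        have := hsgn i
        nlinarith
      -- Small enough that both angular displacements ε a and ε b stay below 1.
      set ε := 1 / (2 + |a| + |b|) with hε
      have hden : 0 < 2 + |a| + |b| := by positivity
      have hε0 : 0 < ε := by positivity
      have hε1 : ε < 1 := by
        rw [hε, div_lt_one hden]
        have := abs_nonneg a
        have := abs_nonneg b
        linarith
      have hlt1 : ∀ c : ℝ, |c| ≤ |a| + |b| → |ε * c| < 1 := by
        intro c hc
        rw [abs_mul, abs_of_pos hε0, hε, div_mul_eq_mul_div, one_mul, div_lt_one hden]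
        linarith
      have h1 := mul_neg_of_inner_unitVec_eq_zero hv h0 (x := ε * a) (y := ε * b)
        (by have : 0 < ε ^ 2 := by positivity
            nlinarith)
        (hlt1 a (by have := abs_nonneg b; linarith)) (hlt1 b (by have := abs_nonneg a; linarith))
      have h2 := hpos i p q hlt' _ (add_mul_mem_uIoo (hne i) hε0 hε1)
      have h3 := hpos' i p q hlt _ (add_mul_mem_uIoo (hne' i) hε0 hε1)
      rw [← neg_sub, inner_neg_left] at h2 h3
      nlinarith
    -- The pair is reversed, so letting the angle tend to `θ i` from the two sides gives opposite
    -- weak inequalities.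
    · intro hs
      have hlt' := hs.lt hlt
      have h1 := inner_unitVec_nonneg_of_forall_uIoo (hne i)
        fun φ hφ => (hpos i q p hlt' φ hφ).le
      have h2 := inner_unitVec_nonneg_of_forall_uIoo (hne' i)
        fun φ hφ => (hpos' i p q hlt φ hφ).le
      rw [← neg_sub, inner_neg_left] at h2
      linarith
  · intro i p q h
    exact hpos i p q h _ (add_mul_mem_uIoo (hne i) (by norm_num) (by norm_num))

variable {n t : ℕ} {d : Fin t → ℕ} {A : AllowableSequence (2 * n)} {P : Fin (2 * n) → Plane}

theorem planeDet_eq_zero_of_switch (hP : IsGeometricRealization A P) {i : ℤ}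
    {p q p' q' : Fin (2 * n)} (hpq : p ≠ q) (hpq' : p' ≠ q') (h : A.Switch i p q)
    (h' : A.Switch i p' q') : planeDet (P p - P q) (P p' - P q') = 0 := by
  obtain ⟨u, v, hu, hs, -⟩ := hP.exists_directions
  exact planeDet_eq_zero_of_inner (hu i) ((hs i p q hpq).2 h) ((hs i p' q' hpq').2 h')

theorem planeDet_ne_zero_of_switch (hP : IsGeometricRealization A P) {i : ℤ}
    {p q p' q' : Fin (2 * n)} (hpq : p ≠ q) (hpq' : p' ≠ q') (h : A.Switch i p q)
    (h' : ¬ A.Switch i p' q') : planeDet (P p - P q) (P p' - P q') ≠ 0 := by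
  obtain ⟨u, v, hu, hs, -⟩ := hP.exists_directions
  intro h0
  have h1 : P p - P q ≠ 0 := sub_ne_zero.2 fun h => hpq (hP.1 h)
  obtain ⟨a, ha⟩ := exists_smul_of_planeDet h1 h0
  refine h' ((hs i p' q' hpq').1 ?_)
  rw [ha, inner_smul_left, (hs i p q hpq).2 h, mul_zero]

theorem planeDet_conj_ne_zero (hA : A.IsDCcsncgen d) (hP : IsGeometricRealization A P)
    {k l : Fin t} (hkl : k ≠ l) {p q : Fin (2 * n)} (hp : p ∈ A.crossingSubstring k)
    (hq : q ∈ A.crossingSubstring l) : planeDet (P p - P p.rev) (P q - P q.rev) ≠ 0 := by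
  refine hP.planeDet_ne_zero_of_switch (rev_ne p) (rev_ne q)
    ((hA.mem_crossingSubstring_iff_switch k p).1 hp) fun h => hkl ?_
  exact hA.eq_of_mem_crossingSubstring ((hA.mem_crossingSubstring_iff_switch k q).2 h) hq

theorem rev_mem_crossingSubstring (hA : A.IsDCcsncgen d) {k : Fin t} {p : Fin (2 * n)}
    (hp : p ∈ A.crossingSubstring k) : p.rev ∈ A.crossingSubstring k := by
  rw [hA.mem_crossingSubstring_iff] at *
  rwa [hA.isSymmetricNearCritical.depth_rev]

theorem add_conj_eq (hA : A.IsDCcsncgen d) (hP : IsGeometricRealization A P)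
    {k l : Fin t} (hkl : k ≠ l) {p q : Fin (2 * n)} (hp : p ∈ A.crossingSubstring k)
    (hq : q ∈ A.crossingSubstring l) : P p + P p.rev = P q + P q.rev := by
  have hS := hA.isSymmetricNearCritical
  have key : ∀ q, q ∈ A.crossingSubstring l → planeDet (P p - P q) (P p.rev - P q.rev) = 0 := by
    intro q hq
    have hpq : p ≠ q := by
      rintro rfl
      exact hkl (hA.eq_of_mem_crossingSubstring hp hq)
    obtain ⟨i, -, -, hi⟩ := A.exists_switch 0 hpq
    exact hP.planeDet_eq_zero_of_switch hpq (fun h => hpq (Fin.rev_injective h)) hi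
      (hS.switch_rev hpq hi)
  refine add_eq_add_of_parallel (key q hq) ?_ (hP.planeDet_conj_ne_zero hA hkl hp hq)
  have := key q.rev (rev_mem_crossingSubstring hA hq)
  rwa [Fin.rev_rev] at this

theorem exists_mem_crossingSubstring (hA : A.IsDCcsncgen d) {k : Fin t} :
    ∃ p, p ∈ A.crossingSubstring k := by
  have hc := hA.crosses k
  obtain ⟨h1, s, -, h2, -⟩ := hc
  obtain ⟨p, hp, -⟩ := A.exists_depth_eq (A.crossingMove k) (m := 1) le_rfl (by omega)
  exact ⟨p, by rw [hA.mem_crossingSubstring_iff]; omega⟩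

/-- The points of two crossing substrings are symmetric about a common center. -/
theorem exists_center (hA : A.IsDCcsncgen d) (hP : IsGeometricRealization A P)
    {k l : Fin t} (hkl : k ≠ l) : ∃ o : Plane, ∀ p ∈ A.crossingSubstring k ∪ A.crossingSubstring l,
      P p - P p.rev = (2 : ℝ) • (P p - o) ∧ P p.rev = o - (P p - o) := by
  obtain ⟨x, hx⟩ := exists_mem_crossingSubstring hA (k := k)
  obtain ⟨y, hy⟩ := exists_mem_crossingSubstring hA (k := l)
  refine ⟨(1 / 2 : ℝ) • (P x + P x.rev), fun p hp => ?_⟩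
  have hsum : P p + P p.rev = P x + P x.rev := by
    rcases hp with hp | hp
    · rw [hP.add_conj_eq hA hkl hp hy, hP.add_conj_eq hA hkl hx hy]
    · rw [hP.add_conj_eq hA hkl hx hp]
  have h2 : P p.rev = P x + P x.rev - P p := by rw [← hsum]; module
  rw [h2]
  constructor <;> module

/-- All conjugate pairs of a substring meet in its crossing move, so their chords through o are
parallel and hence collinear. -/
theorem exists_smul_of_mem (hA : A.IsDCcsncgen d) (hP : IsGeometricRealization A P) {k : Fin t}
    {o : Plane} (ho : ∀ p ∈ A.crossingSubstring k, P p - P p.rev = (2 : ℝ) • (P p - o))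
    {p q : Fin (2 * n)} (hp : p ∈ A.crossingSubstring k) (hq : q ∈ A.crossingSubstring k) :
    ∃ a : ℝ, P q - o = a • (P p - o) := by
  have h0 := hP.planeDet_eq_zero_of_switch (rev_ne p) (rev_ne q)
    ((hA.mem_crossingSubstring_iff_switch k p).1 hp)
    ((hA.mem_crossingSubstring_iff_switch k q).1 hq)
  have h1 : P p - P p.rev ≠ 0 := sub_ne_zero.2 fun h => rev_ne p (hP.1 h)
  obtain ⟨a, ha⟩ := exists_smul_of_planeDet h1 h0
  refine ⟨a, ?_⟩
  rw [ho p hp, ho q hq] at ha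
  have := congrArg (fun z : Plane => (1 / 2 : ℝ) • z) ha
  simp only [smul_smul] at this
  norm_num at this
  rw [this]
  congr 1
  ring

theorem planeDet_sub_center_ne_zero (hA : A.IsDCcsncgen d) (hP : IsGeometricRealization A P)
    {k l : Fin t} (hkl : k ≠ l) {o : Plane}
    (ho : ∀ p ∈ A.crossingSubstring k ∪ A.crossingSubstring l,
      P p - P p.rev = (2 : ℝ) • (P p - o)) {p q : Fin (2 * n)}
    (hp : p ∈ A.crossingSubstring k) (hq : q ∈ A.crossingSubstring l) :
    planeDet (P p - o) (P q - o) ≠ 0 := by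
  have h := hP.planeDet_conj_ne_zero hA hkl hp hq
  rw [ho p (Or.inl hp), ho q (Or.inr hq)] at h
  intro h0
  apply h
  simp only [planeDet, PiLp.smul_apply, smul_eq_mul] at h0 ⊢
  linear_combination 4 * h0

theorem isCentrallySymmetricBipencil (hA : A.IsDCcsncgen d) (hP : IsGeometricRealization A P)
    {k l : Fin t} (hkl : k ≠ l) (hl : d l = 1) :
    IsCentrallySymmetricBipencil (P '' (A.crossingSubstring k ∪ A.crossingSubstring l)) := by
  have hS := hA.isSymmetricNearCritical
  obtain ⟨o, ho⟩ := hP.exists_center hA hkl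
  obtain ⟨x, hx⟩ := exists_mem_crossingSubstring hA (k := k)
  obtain ⟨y, hy⟩ := exists_mem_crossingSubstring hA (k := l)
  have hdet := fun z hz => hP.planeDet_sub_center_ne_zero hA hkl (fun p hp => (ho p hp).1) hx
    (q := z) hz
  refine ⟨Set.toFinite _, ⟨o, ?_⟩, AffineSubspace.mk' o (Submodule.span ℝ {P x - o}), ?_, ?_⟩
  · rintro _ ⟨p, hp, rfl⟩
    refine ⟨p.rev, ?_, ?_⟩
    · exact hp.imp (rev_mem_crossingSubstring hA) (rev_mem_crossingSubstring hA)
    · rw [(ho p hp).2, AffineEquiv.pointReflection_apply, vsub_eq_sub, vadd_eq_add]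
      module
  · rw [AffineSubspace.direction_mk', finrank_span_singleton]
    intro h0
    refine hdet y hy ?_
    simp [h0, planeDet]
  · have hmem : ∀ z : Plane, z ∈ AffineSubspace.mk' o (Submodule.span ℝ {P x - o}) ↔
        ∃ a : ℝ, a • (P x - o) = z - o := fun z => by
      rw [AffineSubspace.mem_mk', vsub_eq_sub, Submodule.mem_span_singleton]
    have hset : P '' (A.crossingSubstring k ∪ A.crossingSubstring l) \
        (AffineSubspace.mk' o (Submodule.span ℝ {P x - o}) : Set Plane) =
          P '' A.crossingSubstring l := by
      ext z
      constructor
      · rintro ⟨⟨p, hp | hp, rfl⟩, hz⟩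
        · refine absurd ((hmem _).2 ?_) hz
          obtain ⟨a, ha⟩ := hP.exists_smul_of_mem hA (fun p hp => (ho p (Or.inl hp)).1) hx hp
          exact ⟨a, ha.symm⟩
        · exact ⟨p, hp, rfl⟩
      · rintro ⟨p, hp, rfl⟩
        refine ⟨⟨p, Or.inr hp, rfl⟩, fun hz => ?_⟩
        obtain ⟨a, ha⟩ := (hmem _).1 hz
        refine hdet p hp ?_
        rw [← ha]
        simp only [planeDet, PiLp.smul_apply, smul_eq_mul]
        ring
    rw [hset, Set.ncard_image_of_injective _ hP.1, hA.signature.2 l, hl]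

/-- A crossing substring whose points, ordered by depth, are at the multiples `c ^ r • v`
of a vector `v` from the center is realized by an exponential pencil. -/
theorem image_crossingSubstring_eq (hA : A.IsDCcsncgen d) {k : Fin t} {x : ℕ → Fin (2 * n)}
    (hx : ∀ r < d k, A.depth (A.crossingMove k) (x r) = r + 1) {o v : Plane} {c : ℝ}
    (ho : ∀ p ∈ A.crossingSubstring k, P p.rev = o - (P p - o))
    (hv : ∀ r < d k, P (x r) - o = c ^ r • v) :
    P '' A.crossingSubstring k = expPencil c o v (d k - 1) := by
  have hS := hA.isSymmetricNearCritical
  have hpos := (hA.crosses k).1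
  have hmem : ∀ r < d k, x r ∈ A.crossingSubstring k := fun r hr => by
    rw [hA.mem_crossingSubstring_iff, hx r hr]
    omega
  have h1 : ∀ r < d k, P (x r) = o + c ^ r • v := fun r hr => by rw [← hv r hr]; module
  have h2 : ∀ r < d k, P (x r).rev = o - c ^ r • v := fun r hr => by
    rw [ho _ (hmem r hr), hv r hr]
  ext z
  constructor
  · rintro ⟨p, hp, rfl⟩
    rw [hA.mem_crossingSubstring_iff] at hp
    have h3 := one_le_depth (A := A) (i := A.crossingMove k) (p := p)
    obtain ⟨r, hr⟩ := Int.eq_ofNat_of_zero_le (a := A.depth (A.crossingMove k) p - 1) (by omega)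
    have hrd : r < d k := by omega
    have hxr := hx r hrd
    refine ⟨r, by omega, ?_⟩
    have : p = x r ∨ p = (x r).rev := by
      have h4 : A.perm (A.crossingMove k) p = A.perm (A.crossingMove k) (x r) ∨
          A.perm (A.crossingMove k) p = A.perm (A.crossingMove k) (x r).rev := by
        rw [hS.perm_rev, Fin.ext_iff, Fin.ext_iff, Fin.val_rev]
        unfold depth at hr hxr
        omega
      exact h4.imp (fun h => (A.perm _).injective h) (fun h => (A.perm _).injective h)
    rcases this with rfl | rfl
    · exact Or.inl (h1 r hrd)
    · exact Or.inr (h2 r hrd)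
  · rintro ⟨r, hr, rfl | rfl⟩
    · exact ⟨x r, hmem r (by omega), h1 r (by omega)⟩
    · exact ⟨(x r).rev, rev_mem_crossingSubstring hA (hmem r (by omega)), h2 r (by omega)⟩

/-- Translating both depths by 1 does not change the move of the meeting. The resulting parallel
lines force both sequences of coordinates to be powers of one ratio. -/
theorem exists_expPencil (hA : A.IsDCcsncgen d) (hP : IsGeometricRealization A P)
    {k l : Fin t} (hkl : k < l) (hk : 2 ≤ d k) (hl : 2 ≤ d l) :
    ∃ (c : ℝ) (o v w : Plane), 1 < c ∧ planeDet v w ≠ 0 ∧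
      P '' A.crossingSubstring k = expPencil c o v (d k - 1) ∧
      P '' A.crossingSubstring l = expPencil c o w (d l - 1) := by
  have hS := hA.isSymmetricNearCritical
  have hkn : d k ≤ n := by
    obtain ⟨-, s, -, h1, -⟩ := hA.crosses k
    omega
  have hln : d l ≤ n := by
    obtain ⟨-, s, -, h1, -⟩ := hA.crosses l
    omega
  obtain ⟨o, ho⟩ := hP.exists_center hA hkl.ne
  -- The index r corresponds to depth r + 1; beyond n the point is arbitrary, so that `choose`
  -- yields total sequences.
  have hex : ∀ (i : ℤ) (r : ℕ), ∃ p, r < n → A.depth i p = r + 1 ∧ n ≤ (A.perm i p : ℕ) := by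
    intro i r
    by_cases hr : r < n
    · obtain ⟨p, hp⟩ := A.exists_depth_eq i (m := r + 1) (by omega) (by omega)
      exact ⟨p, fun _ => hp⟩
    · exact ⟨⟨0, by omega⟩, fun h => absurd h hr⟩
  choose x hx using hex (A.crossingMove k)
  -- The side of y is fixed at the preceding crossing of its substring, since it must be on the
  -- right on the way in to crossing l.
  choose y hy using hex (A.crossingMove l - 2 * n)
  have hyd : ∀ s, s < n → A.depth (A.crossingMove l) (y s) = s + 1 := fun s hs => by
    have h1 := (hy s hs).1
    have h2 : A.depth (A.crossingMove l - A.halfLength) (y s) = A.depth (A.crossingMove l) (y s) :=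
      depth_sub_halfLength
    rw [hS.halfLength_eq] at h2
    push_cast at h2
    rw [← h2, h1]
  have hxk : ∀ r < d k, x r ∈ A.crossingSubstring k := fun r hr => by
    rw [hA.mem_crossingSubstring_iff, (hx r (by omega)).1]
    omega
  have hyl : ∀ s < d l, y s ∈ A.crossingSubstring l := fun s hs => by
    rw [hA.mem_crossingSubstring_iff, hyd s (by omega)]
    omega
  have hxe : ∀ r, ∃ a : ℝ, r < d k → P (x r) - o = a • (P (x 0) - o) := fun r => by
    by_cases hr : r < d k
    · obtain ⟨a, ha⟩ := hP.exists_smul_of_mem hA (fun p hp => (ho p (Or.inl hp)).1)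
        (hxk 0 (by omega)) (hxk r hr)
      exact ⟨a, fun _ => ha⟩
    · exact ⟨0, fun h => absurd h hr⟩
  have hye : ∀ s, ∃ b : ℝ, s < d l → P (y s) - o = b • (P (y 0) - o) := fun s => by
    by_cases hs : s < d l
    · obtain ⟨b, hb⟩ := hP.exists_smul_of_mem hA (fun p hp => (ho p (Or.inr hp)).1)
        (hyl 0 (by omega)) (hyl s hs)
      exact ⟨b, fun _ => hb⟩
    · exact ⟨0, fun h => absurd h hs⟩
  choose a ha using hxe
  choose b hb using hye
  have hdet : planeDet (P (x 0) - o) (P (y 0) - o) ≠ 0 :=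
    hP.planeDet_sub_center_ne_zero hA hkl.ne (fun p hp => (ho p hp).1) (hxk 0 (by omega))
      (hyl 0 (by omega))
  set v := P (x 0) - o with hv
  set w := P (y 0) - o with hw
  have hv0 : v ≠ 0 := by
    intro h0
    apply hdet
    simp [h0, planeDet]
  have hw0 : w ≠ 0 := by
    intro h0
    apply hdet
    simp [h0, planeDet]
  have ha0 : a 0 = 1 := by
    have h1 : (1 : ℝ) • v = a 0 • v := by rw [one_smul]; exact ha 0 (by omega)
    exact (smul_left_injective ℝ hv0 h1).symm
  have hb0 : b 0 = 1 := by
    have h1 : (1 : ℝ) • w = b 0 • w := by rw [one_smul]; exact hb 0 (by omega)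
    exact (smul_left_injective ℝ hw0 h1).symm
  obtain ⟨e, he⟩ := hA.exists_parity
  have hek := he k
  have hel := he l
  have hmul : ∀ r s, r + 1 < d k → s + 1 < d l → a r * b (s + 1) = a (r + 1) * b s := by
    intro r s hr hs
    have hne : ∀ r s, r < d k → s < d l → x r ≠ y s := by
      intro r s hr hs h
      have := hyl s hs
      rw [← h] at this
      exact hkl.ne (hA.eq_of_mem_crossingSubstring (hxk r hr) this)
    -- The exact spacing of the crossings makes this number even, so the move of the meeting is an
    -- integer.
    obtain ⟨m, hm⟩ : (2 : ℤ) ∣ A.crossingMove k + A.crossingMove l + d k - d l +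
      2 * ((s + 1) - (r + 1)) := by omega
    have s1 := hA.switch_of_crossingMove_lt hkl (hxk r (by omega)) (hyl s (by omega))
      (hx r (by omega)).2 (hy s (by omega)).2 (m := m) (by
        rw [hyd s (by omega), (hx r (by omega)).1, hm])
    have s2 := hA.switch_of_crossingMove_lt hkl (hxk (r + 1) (by omega)) (hyl (s + 1) (by omega))
      (hx (r + 1) (by omega)).2 (hy (s + 1) (by omega)).2 (m := m) (by
        rw [hyd (s + 1) (by omega), (hx (r + 1) (by omega)).1, ← hm]
        push_cast
        ring)
    have h0 := hP.planeDet_eq_zero_of_switch (hne r s (by omega) (by omega))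
      (hne (r + 1) (s + 1) (by omega) (by omega)) s1 s2
    have key : ∀ r s, r < d k → s < d l → P (x r) - P (y s) = a r • v - b s • w := by
      intro r s hr hs
      rw [← ha r hr, ← hb s hs]
      module
    rw [key r s (by omega) (by omega), key (r + 1) (s + 1) (by omega) (by omega)] at h0
    refine mul_right_cancel₀ hdet ?_
    simp only [planeDet, PiLp.sub_apply, PiLp.smul_apply, smul_eq_mul] at h0 ⊢
    linear_combination -h0
  have hab : b 1 = a 1 := by
    have := hmul 0 0 (by omega) (by omega)
    rwa [ha0, hb0, one_mul, mul_one, zero_add] at this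
  have hapow : ∀ r < d k, a r = a 1 ^ r := by
    intro r
    induction r with
    | zero => intro _; rw [ha0, pow_zero]
    | succ r ih =>
      intro hr
      have := hmul r 0 hr (by omega)
      rw [hb0, mul_one, zero_add, hab, ih (by omega)] at this
      rw [← this, pow_succ]
  have hbpow : ∀ s < d l, b s = a 1 ^ s := by
    intro s
    induction s with
    | zero => intro _; rw [hb0, pow_zero]
    | succ s ih =>
      intro hs
      have := hmul 0 s (by omega) hs
      rw [ha0, one_mul, zero_add, ih (by omega)] at this
      rw [this, pow_succ']
  refine ⟨a 1, o, v, w, ?_, hdet, ?_, ?_⟩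
  -- Just after crossing k the projections of the conjugate of x 0, of x 0 and of x 1 occur in this
  -- order, so x 1 is farther from o than x 0 on the same ray.
  · obtain ⟨-, dir, -, -, hdir⟩ := hP.exists_directions
    have x0 := hx 0 (by omega)
    have x1 := hx 1 (by omega)
    have h1 := hdir (A.crossingMove k) (x 0).rev (x 0) (by
      rw [hS.perm_rev, Fin.lt_def, Fin.val_rev]
      omega)
    have h2 := hdir (A.crossingMove k) (x 0) (x 1) (by
      rw [Fin.lt_def]
      unfold depth at x0 x1
      omega)
    rw [(ho _ (Or.inl (hxk 0 (by omega)))).1, inner_smul_left] at h1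
    have h3 : P (x 1) - P (x 0) = (a 1 - 1) • v := by
      rw [sub_smul, ← ha 1 (by omega), one_smul]
      module
    rw [h3, inner_smul_left] at h2
    have h4 : 0 < inner ℝ v (dir (A.crossingMove k)) := by
      simp only [conj_trivial] at h1
      linarith
    simp only [conj_trivial] at h2
    linarith [(pos_iff_pos_of_mul_pos h2).2 h4]
  · exact image_crossingSubstring_eq hA (fun r hr => (hx r (by omega)).1)
      (fun p hp => (ho p (Or.inl hp)).2) fun r hr => by rw [ha r hr, hapow r hr]
  · exact image_crossingSubstring_eq hA (fun s hs => hyd s (by omega))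
      (fun p hp => (ho p (Or.inr hp)).2) fun s hs => by rw [hb s hs, hbpow s hs]

end IsGeometricRealization

theorem planeDet_swap (v w : Plane) : planeDet w v = -planeDet v w := by
  unfold planeDet
  ring

theorem corollary4p5 {n t : ℕ} (d : Fin t → ℕ) (hd : ∀ k, 1 ≤ d k)
    (A : AllowableSequence (2 * n)) (hA : A.IsDCcsncgen d)
    (i j : Fin t) (hij : i ≠ j) (hi : 2 ≤ d i)
    (P : Fin (2 * n) → Plane) (hP : IsGeometricRealization A P) :
    (d j = 1 → IsCentrallySymmetricBipencil
      (P '' (A.crossingSubstring i ∪ A.crossingSubstring j))) ∧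
    (2 ≤ d j → ∃ l : ℝ, 1 < l ∧ AffinelyEquivalent
      (P '' (A.crossingSubstring i ∪ A.crossingSubstring j))
      (expCrossStar l (d i - 1) (d j - 1))) := by
  refine ⟨hP.isCentrallySymmetricBipencil hA hij, fun hj => ?_⟩
  rcases lt_or_gt_of_ne hij with hlt | hlt
  · obtain ⟨c, o, v, w, hc, hdet, h1, h2⟩ := hP.exists_expPencil hA hlt hi hj
    refine ⟨c, hc, ?_⟩
    rw [Set.image_union, h1, h2]
    exact affinelyEquivalent_expCrossStar hdet _ _
  · obtain ⟨c, o, v, w, hc, hdet, h1, h2⟩ := hP.exists_expPencil hA hlt hj hi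
    refine ⟨c, hc, ?_⟩
    rw [Set.image_union, h1, h2]
    refine affinelyEquivalent_expCrossStar ?_ _ _
    rwa [planeDet_swap, neg_ne_zero]
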